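/- All graphs are finite and simple. For a graph $G=(V,E)$, a vertex $v\in V$ and an integer $r\ge 0$, the ball $B_r(v)$ is the set of vertices at distance at most $r$ from $v$ in $G$ (vertices in different components are at infinite distance). A ball hypergraph of $G$ is a hypergraph with vertex set $V$ each of whose edges is a ball $B_r(v)$, for some $v \in V$ and some integer $r\ge 0$, where $r$ may vary from edge to edge. For a hypergraph $\mathcal{H}$, let $\nu(\mathcal{H})$ be the maximum number of pairwise disjoint edges of $\mathcal{H}$, and let $\tau(\mathcal{H})$ be the minimum size of a set of vertices that intersects every edge of $\mathcal{H}$. Theorem. For every integer $t\ge 1$ there is a constant $c_t$ such that $\tau(\mathcal{H})\le c_t\cdot\nu(\mathcal{H})$ for every graph $G$ that does not contain the complete graph $K_t$ as a minor and every ball hypergraph $\mathcal{H}$ of $G$. -/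

import Mathlib

namespace Hypergraph

/-- A matching: a set of pairwise vertex-disjoint edges. -/
def IsMatching {V : Type*} (H : Hypergraph V) (M : Set (Set V)) : Prop :=
  M ⊆ H.edgeSet ∧ ∀ e ∈ M, ∀ f ∈ M, e ≠ f → Disjoint e f

/-- A transversal: a set of vertices that intersects every edge. -/
def IsTransversal {V : Type*} (H : Hypergraph V) (X : Set V) : Prop :=
  X ⊆ H.vertexSet ∧ ∀ e ∈ H.edgeSet, (X ∩ e).Nonempty

/-- The matching number `ν(H)`: the maximum number of edges in a matching. -/
noncomputable def matchingNumber {V : Type*} (H : Hypergraph V) : ℕ :=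
  sSup {n : ℕ | ∃ M : Finset (Set V), H.IsMatching (M : Set (Set V)) ∧ M.card = n}

/-- The transversal number `τ(H)`: the minimum size of a transversal. -/
noncomputable def transversalNumber {V : Type*} (H : Hypergraph V) : ℕ :=
  sInf {n : ℕ | ∃ X : Finset V, H.IsTransversal (X : Set V) ∧ X.card = n}

/-- On a finite vertex set the matching number is a genuine maximum. -/
theorem isGreatest_matchingNumber {V : Type*} [Finite V] (H : Hypergraph V) :
    IsGreatest {n : ℕ | ∃ M : Finset (Set V), H.IsMatching (M : Set (Set V)) ∧ M.card = n}
      H.matchingNumber := by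
  have hb : BddAbove {n : ℕ | ∃ M : Finset (Set V),
      H.IsMatching (M : Set (Set V)) ∧ M.card = n} := by
    refine ⟨Nat.card (Set V), ?_⟩
    rintro n ⟨M, -, rfl⟩
    have := Fintype.ofFinite (Set V)
    rw [Nat.card_eq_fintype_card]
    exact M.card_le_univ
  have hn : {n : ℕ | ∃ M : Finset (Set V),
      H.IsMatching (M : Set (Set V)) ∧ M.card = n}.Nonempty :=
    ⟨0, ∅, by simp [IsMatching], rfl⟩
  exact ⟨Nat.sSup_mem hn hb, fun n h => le_csSup hb h⟩

/-- If the vertex set is finite and all edges are nonempty, then a transversal exists and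
the transversal number is a genuine minimum. -/
theorem isLeast_transversalNumber {V : Type*} [Finite V] (H : Hypergraph V)
    (hne : ∀ e ∈ H.edgeSet, e.Nonempty) :
    IsLeast {n : ℕ | ∃ X : Finset V, H.IsTransversal (X : Set V) ∧ X.card = n}
      H.transversalNumber := by
  classical
  have := Fintype.ofFinite V
  have hn : {n : ℕ | ∃ X : Finset V, H.IsTransversal (X : Set V) ∧ X.card = n}.Nonempty := by
    refine ⟨_, H.vertexSet.toFinset, ⟨by simp, fun e he => ?_⟩, rfl⟩
    obtain ⟨x, hx⟩ := hne e he
    exact ⟨x, by simpa using H.mem_vertexSet_of_mem_edgeSet he hx, hx⟩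
  exact ⟨Nat.sInf_mem hn, fun n h => Nat.sInf_le h⟩

end Hypergraph

namespace SimpleGraph

/-- The ball `B_r(v)`: all vertices at distance at most `r` from `v`. Vertices in different
components are at infinite distance, hence the use of `edist`. -/
def closedBall {V : Type*} (G : SimpleGraph V) (v : V) (r : ℕ) : Set V :=
  {u : V | G.edist u v ≤ (r : ℕ∞)}

/-- A ball hypergraph of `G`: a hypergraph whose vertex set is the vertex set of `G` and each
of whose edges is a ball in `G`. -/
def IsBallHypergraph {V : Type*} (G : SimpleGraph V) (H : Hypergraph V) : Prop :=
  H.vertexSet = Set.univ ∧ ∀ e ∈ H.edgeSet, ∃ (v : V) (r : ℕ), e = G.closedBall v r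

/-- `F` is a minor of `G`: there are pairwise disjoint branch sets in `G`, one for each vertex
of `F`, each inducing a connected (in particular nonempty) subgraph, such that the branch sets
of adjacent vertices of `F` are joined by an edge of `G`. -/
def IsMinor {W V : Type*} (F : SimpleGraph W) (G : SimpleGraph V) : Prop :=
  ∃ B : W → Set V,
    (∀ i, (G.induce (B i)).Connected) ∧
    (∀ i j, i ≠ j → Disjoint (B i) (B j)) ∧
    (∀ i j, F.Adj i j → ∃ u ∈ B i, ∃ v ∈ B j, G.Adj u v)

/-- `G` is `K_t`-minor-free: the complete graph on `t` vertices is not a minor of `G`. -/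
def CompleteMinorFree {V : Type*} (G : SimpleGraph V) (t : ℕ) : Prop :=
  ¬ IsMinor (SimpleGraph.completeGraph (Fin t)) G

end SimpleGraph

/-! Only inclusion-minimal balls matter, so consider an antichain of balls `B_{r i}(c i)`, with `R`
the largest radius. Give the site `c i` the offset `R - r i` and form the additively weighted
Voronoi diagram. A vertex lies in a ball iff its weighted distance to the centre is at most `R`, and
the antichain condition says exactly that each centre lies in its own cell. Cells are connected and
disjoint, so the graph of touching cells is a minor of `G` and by Mader's theorem is `2 ^
t`-degenerate. Following geodesics shows that the balls through any given vertex are connected in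
this graph. Hence every subfamily has a sparse support (`exists_support`). The diagram with zero
offsets shows that no `t` vertices have all their pairs cut out by balls (`not_all_pairs`), so
traces of balls have VC dimension below `t`.

The rest concerns set families with these two properties. Clarkson–Shor sampling bounds the weight
of intersecting pairs in a fractional matching, and a greedy choice makes it integral up to a
constant (`HasSparseSupports.exists_disjoint`). By minimax there is then a probability measure
giving each member weight of order at least `1 / ν` (`HasSparseSupports.exists_weights`). Finally,
members of weight at least `ε` are hit by `O(1 / ε)` points (`exists_linear_net`): a separated
subfamily has `O(1 / ε)` members because its support is sparse, and around each of them a bounded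
`ε`-net at a constant scale suffices. -/

open Finset

/-! ### Minors, contraction and Mader's theorem -/

namespace SimpleGraph

/-- The graph on the index set of a family of vertex sets in which two distinct indices are
adjacent when `G` has an edge between the corresponding sets. -/
def touching {V W : Type*} (G : SimpleGraph V) (C : W → Set V) : SimpleGraph W where
  Adj i j := i ≠ j ∧ ∃ u ∈ C i, ∃ v ∈ C j, G.Adj u v
  symm := ⟨fun _ _ h => ⟨h.1.symm, by
    obtain ⟨-, u, hu, v, hv, huv⟩ := h
    exact ⟨v, hv, u, hu, huv.symm⟩⟩⟩
  loopless := ⟨fun _ h => h.1 rfl⟩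

theorem isMinor_touching {V W : Type*} {G : SimpleGraph V} {C : W → Set V}
    (hconn : ∀ i, (G.induce (C i)).Connected) (hdisj : ∀ i j, i ≠ j → Disjoint (C i) (C j)) :
    IsMinor (G.touching C) G :=
  ⟨C, hconn, hdisj, fun _ _ h => h.2⟩

theorem reachable_induce_mono {V : Type*} {G : SimpleGraph V} {s t : Set V} (hst : s ⊆ t)
    {u v : V} {hu : u ∈ s} {hv : v ∈ s} (h : (G.induce s).Reachable ⟨u, hu⟩ ⟨v, hv⟩) :
    (G.induce t).Reachable ⟨u, hst hu⟩ ⟨v, hst hv⟩ :=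
  h.map (G.induceHomOfLE hst).toHom

/-- Branch sets are unions of branch sets; a walk in `Q` lifts to `G` because consecutive sets `C j`
are connected and joined by an edge. -/
theorem IsMinor.trans {W U V : Type*} {F : SimpleGraph W} {Q : SimpleGraph U} {G : SimpleGraph V}
    (hFQ : IsMinor F Q) (hQG : IsMinor Q G) : IsMinor F G := by
  obtain ⟨B, hB, hBd, hBa⟩ := hFQ
  obtain ⟨C, hC, hCd, hCa⟩ := hQG
  refine ⟨fun i => {v | ∃ j ∈ B i, v ∈ C j}, fun i => ?_, fun i j hij => ?_, fun i j hij => ?_⟩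
  · have hsub : ∀ j ∈ B i, C j ⊆ {v | ∃ j ∈ B i, v ∈ C j} := fun j hj v hv => ⟨j, hj, hv⟩
    have key : ∀ a b : B i, (Q.induce (B i)).Walk a b → ∀ (u : V) (hu : u ∈ C a) (v : V)
        (hv : v ∈ C b), (G.induce {v | ∃ j ∈ B i, v ∈ C j}).Reachable
          ⟨u, hsub a a.2 hu⟩ ⟨v, hsub b b.2 hv⟩ := by
      intro a b w
      induction w with
      | nil =>
        intro u hu v hv
        exact reachable_induce_mono (hsub _ (Subtype.prop _)) ((hC _).preconnected ⟨u, hu⟩ ⟨v, hv⟩)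
      | @cons a c b hac w ih =>
        intro u hu v hv
        obtain ⟨x, hx, y, hy, hxy⟩ := hCa _ _ hac
        have h1 := reachable_induce_mono (hsub a a.2) ((hC a).preconnected ⟨u, hu⟩ ⟨x, hx⟩)
        have h2 : (G.induce {v | ∃ j ∈ B i, v ∈ C j}).Adj ⟨x, hsub a a.2 hx⟩ ⟨y, hsub c c.2 hy⟩ :=
          hxy
        exact (h1.trans h2.reachable).trans (ih y hy v hv)
    obtain ⟨j⟩ := (hB i).nonempty
    obtain ⟨v⟩ := (hC j).nonempty
    have : Nonempty {v | ∃ j ∈ B i, v ∈ C j} := ⟨⟨v, hsub j j.2 v.2⟩⟩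
    refine ⟨?_⟩
    rintro ⟨u, j, hj, hu⟩ ⟨v, k, hk, hv⟩
    obtain ⟨w⟩ := (hB i).preconnected ⟨j, hj⟩ ⟨k, hk⟩
    exact key _ _ w u hu v hv
  · rw [Set.disjoint_left]
    rintro v ⟨a, ha, hva⟩ ⟨b, hb, hvb⟩
    have hab : a ≠ b := fun h => Set.disjoint_left.1 (hBd i j hij) ha (h ▸ hb)
    exact Set.disjoint_left.1 (hCd a b hab) hva hvb
  · obtain ⟨a, ha, b, hb, hab⟩ := hBa i j hij
    obtain ⟨u, hu, v, hv, huv⟩ := hCa a b hab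
    exact ⟨u, ⟨a, ha, hu⟩, v, ⟨b, hb, hv⟩, huv⟩

theorem connected_induce_singleton {V : Type*} (G : SimpleGraph V) (v : V) :
    (G.induce {v}).Connected :=
  haveI : Subsingleton ({v} : Set V) := Set.subsingleton_singleton.coe_sort
  ⟨Preconnected.of_subsingleton⟩

theorem connected_induce_image_val {V : Type*} {G : SimpleGraph V} {s : Set V} {b : Set s}
    (h : ((G.induce s).induce b).Connected) : (G.induce (Subtype.val '' b)).Connected := by
  let f : (G.induce s).induce b →g G.induce (Subtype.val '' b) :=
    ⟨fun x => ⟨x.1.1, x.1, x.2, rfl⟩, fun h => h⟩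
  refine h.map f ?_
  rintro ⟨-, x, hx, rfl⟩
  exact ⟨⟨x, hx⟩, rfl⟩

/-- A complete minor in the neighbourhood of a vertex extends by that vertex. -/
theorem isMinor_completeGraph_succ {V : Type*} {G : SimpleGraph V} {t : ℕ} (x : V)
    (h : IsMinor (completeGraph (Fin t)) (G.induce {v | G.Adj x v})) :
    IsMinor (completeGraph (Fin (t + 1))) G := by
  obtain ⟨B, hB, hBd, hBa⟩ := h
  have hx : ∀ i, Disjoint {x} (Subtype.val '' B i) := by
    intro i
    rw [Set.disjoint_singleton_left]
    rintro ⟨y, -, h⟩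
    exact G.loopless.irrefl x (by simpa [h] using y.2)
  have hxa : ∀ i, ∃ v ∈ Subtype.val '' B i, G.Adj x v := by
    intro i
    obtain ⟨v⟩ := (hB i).nonempty
    exact ⟨v.1, ⟨v.1, v.2, rfl⟩, v.1.2⟩
  refine ⟨Fin.cons {x} fun i => Subtype.val '' B i, fun i => ?_, fun i j hij => ?_,
    fun i j hij => ?_⟩
  · refine Fin.cases ?_ (fun i => ?_) i
    · exact connected_induce_singleton G x
    · exact connected_induce_image_val (hB i)
  · revert hij
    refine Fin.cases ?_ (fun i => ?_) i <;> refine Fin.cases ?_ (fun j => ?_) j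
    · simp
    · exact fun _ => hx j
    · exact fun _ => (hx i).symm
    · intro hij
      simp only [Fin.cons_succ]
      rw [Set.disjoint_image_iff Subtype.val_injective]
      exact hBd i j fun h => hij (congrArg _ h)
  · revert hij
    refine Fin.cases ?_ (fun i => ?_) i <;> refine Fin.cases ?_ (fun j => ?_) j
    · simp
    · intro _
      obtain ⟨v, hv, hxv⟩ := hxa j
      exact ⟨x, rfl, v, hv, hxv⟩
    · intro _
      obtain ⟨v, hv, hxv⟩ := hxa i
      exact ⟨v, hv, x, rfl, hxv.symm⟩
    · intro hij
      obtain ⟨u, hu, v, hv, huv⟩ := hBa i j fun h => hij (congrArg _ h)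
      exact ⟨u, ⟨u, hu, rfl⟩, v, ⟨v, hv, rfl⟩, huv⟩

/-- Contracting the edge `xy`: a graph on the vertices other than `y` that is a minor of `G` and
loses at most `2 + 2 c` ordered adjacent pairs, `c` being the number of common neighbours. -/
theorem exists_contraction {V : Type*} [Fintype V] [DecidableEq V] (G : SimpleGraph V)
    [DecidableRel G.Adj] {x y : V} (hxy : G.Adj x y) :
    ∃ Q : SimpleGraph {v // v ≠ y}, IsMinor Q G ∧
      ∀ _ : DecidableRel Q.Adj, #{p : V × V | G.Adj p.1 p.2} ≤
        #{p : {v // v ≠ y} × {v // v ≠ y} | Q.Adj p.1 p.2} +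
          (2 + 2 * #{v | G.Adj x v ∧ G.Adj y v}) := by
  have hne : x ≠ y := hxy.ne
  -- The vertex `x` of the contracted graph stands for `{x, y}`, every other vertex for itself; `φ`
  -- is the quotient map.
  let C : {v // v ≠ y} → Set V := fun a => {v | v = a ∨ (a = x ∧ v = y)}
  let φ : V → {v // v ≠ y} := fun v => if h : v = y then ⟨x, hne⟩ else ⟨v, h⟩
  have hφ : ∀ v, v ∈ C (φ v) := by
    intro v
    by_cases h : v = y
    · simp [C, φ, h]
    · simp [C, φ, h]
  have hφ1 : ∀ v, v ≠ y → (φ v : V) = v := fun v h => by simp [φ, h]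
  have hφ2 : (φ y : V) = x := by simp [φ]
  refine ⟨G.touching C, isMinor_touching (fun a => ?_) (fun a b hab => ?_), fun _ => ?_⟩
  · by_cases ha : a = x
    · have : C a = {x, y} := by
        ext v; simp [C, ha]
      rw [this]
      exact induce_pair_connected_of_adj hxy
    · have : C a = {a.1} := by
        ext v; simp [C, ha]
      rw [this]
      exact connected_induce_singleton G a
  · rw [Set.disjoint_left]
    rintro v (h | ⟨h, h'⟩) (k | ⟨k, k'⟩)
    · exact hab (Subtype.ext (h.symm.trans k))
    · exact a.2 (h.symm.trans k')
    · exact b.2 (k.symm.trans h')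
    · exact hab (Subtype.ext (h.trans k.symm))
  · set N : Finset V := {v | G.Adj x v ∧ G.Adj y v} with hN
    set A : Finset (V × V) := {p | G.Adj p.1 p.2} with hA
    -- The lost pairs: `xy` in both orders, and, for each common neighbour `v`, the pairs of `y` and
    -- `v`, which merge with those of `x` and `v`.
    set E : Finset (V × V) := {(x, y), (y, x)} ∪ (N.image (fun v => (y, v)) ∪
      N.image (fun v => (v, y))) with hE
    have hEc : #E ≤ 2 + 2 * #N := by
      refine (card_union_le _ _).trans (add_le_add card_le_two ?_)
      refine (card_union_le _ _).trans ?_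
      have h1 := card_image_le (s := N) (f := fun v => (y, v))
      have h2 := card_image_le (s := N) (f := fun v => (v, y))
      omega
    have hinj : #(A \ E) ≤ #{p : {v // v ≠ y} × {v // v ≠ y} | (G.touching C).Adj p.1 p.2} := by
      refine card_le_card_of_injOn (fun p => (φ p.1, φ p.2)) ?_ ?_
      · rintro ⟨u, v⟩ huv
        simp only [coe_sdiff, Set.mem_sdiff, mem_coe, hA, mem_filter, mem_univ, true_and, hE,
          mem_union, mem_insert, mem_singleton, Prod.mk.injEq, not_or] at huv
        simp only [coe_filter, mem_univ, true_and, Set.mem_ofPred_eq]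
        refine ⟨fun h => ?_, u, hφ u, v, hφ v, huv.1⟩
        have h' := congrArg Subtype.val h
        by_cases hu : u = y <;> by_cases hv : v = y
        · exact huv.1.ne (hu.trans hv.symm)
        · subst hu
          rw [hφ2, hφ1 v hv] at h'
          exact huv.2.1.2 ⟨rfl, h'.symm⟩
        · subst hv
          rw [hφ2, hφ1 u hu] at h'
          exact huv.2.1.1 ⟨h', rfl⟩
        · rw [hφ1 u hu, hφ1 v hv] at h'
          exact huv.1.ne h'
      · rintro ⟨u, v⟩ huv ⟨u', v'⟩ huv' h
        simp only [coe_sdiff, Set.mem_sdiff, mem_coe, hA, mem_filter, mem_univ, true_and, hE,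
          mem_union, mem_insert, mem_singleton, Prod.mk.injEq, not_or, mem_image, hN,
          not_exists, not_and] at huv huv'
        simp only [Prod.mk.injEq] at h
        obtain ⟨h1, h2⟩ := h
        have h1' := congrArg Subtype.val h1
        have h2' := congrArg Subtype.val h2
        obtain ⟨ha, ⟨hb, hc⟩, hd, he⟩ := huv
        obtain ⟨ha', ⟨hb', hc'⟩, hd', he'⟩ := huv'
        have hsymm := fun a b => G.adj_comm a b
        have hirr := fun a => G.loopless.irrefl a
        by_cases hu : u = y <;> by_cases hv : v = y <;> by_cases hu' : u' = y <;>
          by_cases hv' : v' = y <;>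
          simp only [hu, hv, hu', hv', hφ2, hφ1, ne_eq, not_false_eq_true] at h1' h2' <;>
          grind
    have := card_le_card_sdiff_add_card (s := A) (t := E)
    omega

/-- A finite graph of average degree at least `2 ^ t` has a `K_t` minor (**Mader**). -/
theorem isMinor_completeGraph_of_le_card_adj {V : Type*} [Fintype V] [Nonempty V] {t : ℕ}
    (G : SimpleGraph V) [DecidableRel G.Adj]
    (h : 2 ^ t * Fintype.card V ≤ #{p : V × V | G.Adj p.1 p.2}) :
    IsMinor (completeGraph (Fin t)) G := by
  classical
  induction t generalizing V with
  | zero => exact ⟨fun i => i.elim0, fun i => i.elim0, fun i => i.elim0, fun i => i.elim0⟩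
  | succ t iht =>
    induction hn : Fintype.card V using Nat.strong_induction_on generalizing V with
    | _ n ih =>
    -- An edge with few common neighbours can be contracted without lowering the density below `2 ^
    -- (t + 1)`. If there is none, each edge has at least `2 ^ t` common neighbours, so the
    -- neighbourhood of a vertex has minimum degree at least `2 ^ t` and contains a `K_t` minor.
    by_cases hc : ∃ x y, G.Adj x y ∧ 2 + 2 * #{v | G.Adj x v ∧ G.Adj y v} ≤ 2 ^ (t + 1)
    · obtain ⟨x, y, hxy, hle⟩ := hc
      obtain ⟨Q, hQ, hcard⟩ := G.exists_contraction hxy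
      have : Nonempty {v // v ≠ y} := ⟨⟨x, hxy.ne⟩⟩
      have hV : Fintype.card {v // v ≠ y} + 1 = Fintype.card V := by
        have h1 := Fintype.card_subtype_compl (fun v => v = y)
        have h2 : 0 < Fintype.card V := Fintype.card_pos
        simp only [Fintype.card_subtype_eq] at h1
        change Fintype.card {v // ¬ v = y} + 1 = _
        omega
      refine (ih _ ?_ Q ?_ rfl).trans hQ
      · omega
      · have := hcard inferInstance
        rw [← hV, mul_add, mul_one] at h
        omega
    · push Not at hc
      have hpos : 0 < #{p : V × V | G.Adj p.1 p.2} :=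
        lt_of_lt_of_le (Nat.mul_pos (by positivity) Fintype.card_pos) h
      obtain ⟨⟨x, y⟩, hxy⟩ := card_pos.1 hpos
      simp only [mem_filter, mem_univ, true_and] at hxy
      have : Nonempty {v | G.Adj x v} := ⟨⟨y, hxy⟩⟩
      refine isMinor_completeGraph_succ x (iht (G.induce {v | G.Adj x v}) ?_)
      have hsum : #{p : {v | G.Adj x v} × {v | G.Adj x v} |
          (G.induce {v | G.Adj x v}).Adj p.1 p.2} =
          ∑ a : {v | G.Adj x v}, #{b : {v | G.Adj x v} | G.Adj a b} := by
        rw [card_filter, ← univ_product_univ, sum_product]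
        refine sum_congr rfl fun a _ => ?_
        rw [card_filter]
        rfl
      rw [hsum, mul_comm]
      refine (le_of_eq ?_).trans (card_nsmul_le_sum univ _ (2 ^ t) fun a _ => ?_)
      · rw [card_univ, smul_eq_mul]
      · have h1 := hc x a a.2
        have h2 : #{v | G.Adj x v ∧ G.Adj a v} ≤ #{b : {v | G.Adj x v} | G.Adj a b} := by
          refine card_le_card_of_surjOn Subtype.val ?_
          intro v hv
          simp only [coe_filter, mem_univ, true_and, Set.mem_ofPred_eq] at hv
          exact ⟨⟨v, hv.1⟩, by simpa using hv.2, rfl⟩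
        rw [pow_succ] at h1
        omega

/-- A nonempty finite graph without `K_t` minor has a vertex of degree at most `2 ^ t`. -/
theorem CompleteMinorFree.exists_card_adj_le {V : Type*} [Fintype V] [Nonempty V] {t : ℕ}
    {G : SimpleGraph V} [DecidableRel G.Adj] (h : G.CompleteMinorFree t) :
    ∃ v, #{w | G.Adj v w} ≤ 2 ^ t := by
  by_contra! hcon
  refine h (isMinor_completeGraph_of_le_card_adj G ?_)
  have hsum : #{p : V × V | G.Adj p.1 p.2} = ∑ a, #{b | G.Adj a b} := by
    rw [card_filter, ← univ_product_univ, sum_product]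
    exact sum_congr rfl fun a _ => (card_filter _ _).symm
  rw [hsum, mul_comm]
  refine (le_of_eq ?_).trans (card_nsmul_le_sum univ _ (2 ^ t) fun a _ => (hcon a).le)
  rw [card_univ, smul_eq_mul]

end SimpleGraph

namespace SimpleGraph

/-! ### Additively weighted Voronoi diagrams in graphs -/

section PowerDiagram

variable {V ι : Type*}

theorem exists_adj_edist_eq_add_one {G : SimpleGraph V} {y c : V} (h : G.edist y c ≠ ⊤)
    (hne : y ≠ c) : ∃ z, G.Adj y z ∧ G.edist y c = G.edist z c + 1 := by
  obtain ⟨p, hp⟩ := exists_walk_of_edist_ne_top h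
  cases p with
  | nil => exact absurd rfl hne
  | @cons _ z _ hyz q =>
    refine ⟨z, hyz, le_antisymm ?_ ?_⟩
    · have h1 := G.edist_triangle (u := y) (v := z) (w := c)
      rwa [edist_eq_one_iff_adj.2 hyz, add_comm] at h1
    · rw [← hp, Walk.length_cons, Nat.cast_add, Nat.cast_one]
      gcongr
      exact edist_le q

/-- The additively weighted distance from `y` to the site `c i` with offset `s i`. -/
noncomputable def powerDist (G : SimpleGraph V) (c : ι → V) (s : ι → ℕ) (y : V) (i : ι) : ℕ∞ :=
  G.edist y (c i) + s i

variable {G : SimpleGraph V} {c : ι → V} {s : ι → ℕ}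

theorem powerDist_le_add_of_adj {y z : V} (h : G.Adj y z) (j : ι) :
    G.powerDist c s y j ≤ G.powerDist c s z j + 1 := by
  have h1 := G.edist_triangle (u := y) (v := z) (w := c j)
  rw [edist_eq_one_iff_adj.2 h] at h1
  unfold powerDist
  calc G.edist y (c j) + s j ≤ 1 + G.edist z (c j) + s j := by gcongr
    _ = _ := by ring

theorem edist_ne_top_of_powerDist_ne_top {i : ι} {y : V} (h : G.powerDist c s y i ≠ ⊤) :
    G.edist y (c i) ≠ ⊤ := fun h' => h (by rw [powerDist, h']; rfl)

variable [LinearOrder ι]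

/-- The cell of `i` in the additively weighted Voronoi diagram of the sites indexed by `S`; ties
are broken in favour of smaller indices. -/
def powerCell (G : SimpleGraph V) (c : ι → V) (s : ι → ℕ) (S : Finset ι) (i : ι) : Set V :=
  {y | G.powerDist c s y i ≠ ⊤ ∧ ∀ j ∈ S, G.powerDist c s y i < G.powerDist c s y j ∨
    (G.powerDist c s y i = G.powerDist c s y j ∧ i ≤ j)}

variable {S : Finset ι}

theorem powerDist_le_of_mem_powerCell {i j : ι} {y : V} (hj : j ∈ S)
    (hy : y ∈ G.powerCell c s S i) : G.powerDist c s y i ≤ G.powerDist c s y j :=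
  (hy.2 j hj).elim le_of_lt fun h => h.1.le

theorem eq_of_mem_powerCell {i j : ι} {y : V} (hi : i ∈ S) (hj : j ∈ S)
    (hyi : y ∈ G.powerCell c s S i) (hyj : y ∈ G.powerCell c s S j) : i = j := by
  have h1 := hyi.2 j hj
  have h2 := hyj.2 i hi
  rcases h1 with h1 | h1 <;> rcases h2 with h2 | h2
  · exact absurd h2 h1.not_gt
  · exact absurd h2.1 h1.ne'
  · exact absurd h1.1 h2.ne'
  · exact le_antisymm h1.2 h2.2

theorem exists_mem_powerCell {i : ι} {y : V} (hi : i ∈ S) (hy : G.powerDist c s y i ≠ ⊤) :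
    ∃ j ∈ S, y ∈ G.powerCell c s S j := by
  obtain ⟨j, hj, hmin⟩ := S.exists_min_image
    (fun k => (toLex (G.powerDist c s y k, k) : ℕ∞ ×ₗ ι)) ⟨i, hi⟩
  refine ⟨j, hj, fun h => ?_, fun k hk => ?_⟩
  · have := Prod.Lex.le_iff.1 (hmin i hi)
    simp only [ofLex_toLex, h] at this
    rcases this with h' | h'
    · exact not_top_lt h'
    · exact hy h'.1.symm
  · exact Prod.Lex.le_iff.1 (hmin k hk)

/-- One step along a geodesic towards `c i` lowers the weighted distance to `i` by exactly one and
to any other site by at most one, so `i` remains the winner, ties included. -/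
theorem mem_powerCell_of_adj {i : ι} {y z : V} (hy : y ∈ G.powerCell c s S i) (h : G.Adj y z)
    (hd : G.edist y (c i) = G.edist z (c i) + 1) : z ∈ G.powerCell c s S i := by
  have hfi : G.powerDist c s y i = G.powerDist c s z i + 1 := by
    unfold powerDist
    rw [hd]
    ring
  refine ⟨fun htop => hy.1 (by rw [hfi, htop]; rfl), fun j hj => ?_⟩
  have hfj := powerDist_le_add_of_adj (c := c) (s := s) h j
  rcases hy.2 j hj with h1 | h1
  · rw [hfi] at h1
    exact Or.inl ((ENat.add_lt_add_iff_right ENat.one_ne_top).1 (h1.trans_le hfj))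
  · rw [← h1.1, hfi] at hfj
    rcases ((ENat.add_le_add_iff_right ENat.one_ne_top).1 hfj).lt_or_eq with h2 | h2
    · exact Or.inl h2
    · exact Or.inr ⟨h2, h1.2⟩

/-- A geodesic from `y` to the site never leaves the cell. -/
theorem exists_reachable_site {i : ι} {y : V} (hy : y ∈ G.powerCell c s S i) :
    ∃ h : c i ∈ G.powerCell c s S i,
      (G.induce (G.powerCell c s S i)).Reachable ⟨y, hy⟩ ⟨c i, h⟩ := by
  obtain ⟨n, hn⟩ := ENat.ne_top_iff_exists.1 (edist_ne_top_of_powerDist_ne_top hy.1)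
  induction n generalizing y with
  | zero =>
    obtain rfl : y = c i := edist_eq_zero_iff.1 (by rw [← hn]; rfl)
    exact ⟨hy, Reachable.refl _⟩
  | succ n ih =>
    have hne : y ≠ c i := by
      rintro rfl
      rw [edist_self] at hn
      exact absurd hn (by exact_mod_cast Nat.succ_ne_zero n)
    obtain ⟨z, hyz, hd⟩ := exists_adj_edist_eq_add_one
      (edist_ne_top_of_powerDist_ne_top hy.1) hne
    have hz := mem_powerCell_of_adj hy hyz hd
    obtain ⟨h, hr⟩ := ih hz (by
      rw [← hn, Nat.cast_add, Nat.cast_one] at hd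
      exact WithTop.add_right_cancel ENat.one_ne_top hd)
    have hadj : (G.induce (G.powerCell c s S i)).Adj ⟨y, hy⟩ ⟨z, hz⟩ := hyz
    exact ⟨h, hadj.reachable.trans hr⟩

theorem connected_powerCell {i : ι} (h : c i ∈ G.powerCell c s S i) :
    (G.induce (G.powerCell c s S i)).Connected := by
  have : Nonempty (G.powerCell c s S i) := ⟨⟨c i, h⟩⟩
  refine ⟨fun u v => ?_⟩
  obtain ⟨_, hu⟩ := exists_reachable_site u.2
  obtain ⟨_, hv⟩ := exists_reachable_site v.2
  exact hu.trans hv.symm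

theorem isMinor_induce_touching_powerCell (hc : ∀ i ∈ S, c i ∈ G.powerCell c s S i)
    {T : Finset ι} (hT : T ⊆ S) :
    IsMinor ((G.touching (G.powerCell c s S)).induce (T : Set ι)) G := by
  refine ⟨fun i => G.powerCell c s S i, fun i => connected_powerCell (hc i (hT i.2)),
    fun i j hij => ?_, fun i j hij => hij.2⟩
  rw [Set.disjoint_left]
  exact fun y hi hj => hij (Subtype.ext (eq_of_mem_powerCell (hT i.2) (hT j.2) hi hj))

/-- The sites within weighted distance `R` of a vertex span a connected part of the adjacency
graph of the cells. -/
theorem preconnected_induce_touching_powerCell (hc : ∀ i ∈ S, c i ∈ G.powerCell c s S i)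
    (v : V) (R : ℕ) :
    ((G.touching (G.powerCell c s S)).induce
      {i | i ∈ S ∧ G.powerDist c s v i ≤ R}).Preconnected := by
  set Q := G.touching (G.powerCell c s S)
  set D : Set ι := {i | i ∈ S ∧ G.powerDist c s v i ≤ R}
  -- Let `y` lie on a geodesic from `v` to `c i`, in the cell of `j`. At `y` the site `j` is at
  -- least as good as `i`, so by the triangle inequality it is so at `v` too, and `j ∈ D`. The
  -- owners met on the way to `c i` thus form a walk inside `D`.
  have key : ∀ (i : ι) (hi : i ∈ D) (n : ℕ) (y : V), (n : ℕ∞) = G.edist y (c i) →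
      G.edist v y + G.edist y (c i) = G.edist v (c i) → ∀ j ∈ S, y ∈ G.powerCell c s S j →
      ∃ h : j ∈ D, (Q.induce D).Reachable ⟨j, h⟩ ⟨i, hi⟩ := by
    intro i hi n
    induction n with
    | zero =>
      intro y hn _ j hj hy
      obtain rfl : y = c i := edist_eq_zero_iff.1 (by rw [← hn]; rfl)
      obtain rfl := eq_of_mem_powerCell hj hi.1 hy (hc i hi.1)
      exact ⟨hi, Reachable.refl _⟩
    | succ n ih =>
      intro y hn hgeo j hj hy
      have hyc : G.edist y (c i) ≠ ⊤ := by
        rw [← hn]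
        exact ENat.natCast_ne_top _
      have hne : y ≠ c i := by
        rintro rfl
        rw [edist_self] at hn
        exact absurd hn (by exact_mod_cast Nat.succ_ne_zero n)
      have hjD : j ∈ D := by
        refine ⟨hj, le_trans ?_ hi.2⟩
        calc G.powerDist c s v j ≤ G.edist v y + G.edist y (c j) + s j := by
              unfold powerDist
              gcongr
              exact G.edist_triangle
          _ = G.edist v y + G.powerDist c s y j := by rw [powerDist, add_assoc]
          _ ≤ G.edist v y + G.powerDist c s y i := by
              gcongr
              exact powerDist_le_of_mem_powerCell hi.1 hy
          _ = G.powerDist c s v i := by rw [powerDist, powerDist, ← add_assoc, hgeo]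
      refine ⟨hjD, ?_⟩
      obtain ⟨z, hyz, hd⟩ := exists_adj_edist_eq_add_one hyc hne
      have hzn : (n : ℕ∞) = G.edist z (c i) := by
        rw [← hn, Nat.cast_add, Nat.cast_one] at hd
        exact WithTop.add_right_cancel ENat.one_ne_top hd
      obtain ⟨k, hk, hzk⟩ : ∃ k ∈ S, z ∈ G.powerCell c s S k := by
        refine exists_mem_powerCell hi.1 ?_
        rw [powerDist, ← hzn]
        exact ENat.natCast_ne_top (n + s i)
      obtain ⟨hkD, hr⟩ := ih z hzn (by
        refine le_antisymm ?_ G.edist_triangle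
        have h1 := G.edist_triangle (u := v) (v := y) (w := z)
        rw [edist_eq_one_iff_adj.2 hyz] at h1
        calc G.edist v z + G.edist z (c i) ≤ G.edist v y + 1 + G.edist z (c i) := by gcongr
          _ = G.edist v y + G.edist y (c i) := by rw [hd]; ring
          _ = _ := hgeo) k hk hzk
      by_cases hjk : j = k
      · subst hjk
        exact hr
      · have hadj : (Q.induce D).Adj ⟨j, hjD⟩ ⟨k, hkD⟩ := ⟨hjk, y, hy, z, hzk, hyz⟩
        exact hadj.reachable.trans hr
  intro i k
  have hfin : ∀ l ∈ D, G.powerDist c s v l ≠ ⊤ := fun l hl h => by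
    have := hl.2
    rw [h] at this
    exact ENat.natCast_ne_top R (top_le_iff.1 this)
  -- The owner of `v` is the common start of all these walks.
  obtain ⟨j, hj, hvj⟩ := exists_mem_powerCell i.2.1 (hfin i i.2)
  have hreach : ∀ l : D, ∃ h : j ∈ D, (Q.induce D).Reachable ⟨j, h⟩ l := by
    intro l
    obtain ⟨n, hn⟩ := ENat.ne_top_iff_exists.1
      (edist_ne_top_of_powerDist_ne_top (hfin l l.2))
    exact key l l.2 n v hn (by rw [edist_self, zero_add]) j hj hvj
  obtain ⟨_, hi⟩ := hreach i
  obtain ⟨_, hk⟩ := hreach k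
  exact hi.symm.trans hk

end PowerDiagram

/-! ### Balls: sparse supports and pairs that cannot be cut out -/

theorem mem_closedBall {V : Type*} {G : SimpleGraph V} {v u : V} {r : ℕ} :
    u ∈ G.closedBall v r ↔ G.edist u v ≤ r := Iff.rfl

theorem self_mem_closedBall {V : Type*} (G : SimpleGraph V) (v : V) (r : ℕ) :
    v ∈ G.closedBall v r := by simp [mem_closedBall]

theorem closedBall_subset_closedBall {V : Type*} {G : SimpleGraph V} {u v : V} {q r : ℕ}
    (h : G.edist u v + q ≤ r) : G.closedBall u q ⊆ G.closedBall v r := by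
  intro w hw
  rw [mem_closedBall] at hw ⊢
  calc G.edist w v ≤ G.edist w u + G.edist u v := G.edist_triangle
    _ ≤ q + G.edist u v := by gcongr
    _ ≤ r := by rwa [add_comm]

/-- An inclusion-antichain of balls in a graph without `K_t` minor has a sparse support: a
`2 ^ t`-degenerate graph on the balls in which the balls containing a given vertex are
connected. -/
theorem CompleteMinorFree.exists_support {V ι : Type*} {G : SimpleGraph V} {t : ℕ}
    (hG : G.CompleteMinorFree t) (c : ι → V) (r : ι → ℕ) (S : Finset ι)
    (hS : ∀ i ∈ S, ∀ j ∈ S, G.closedBall (c i) (r i) ⊆ G.closedBall (c j) (r j) → i = j) :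
    ∃ Q : SimpleGraph ι,
      (∀ T ⊆ S, T.Nonempty → ∃ i ∈ T, {j | j ∈ T ∧ Q.Adj i j}.ncard ≤ 2 ^ t) ∧
      ∀ v, (Q.induce {i | i ∈ S ∧ v ∈ G.closedBall (c i) (r i)}).Preconnected := by
  classical
  let : LinearOrder ι := linearOrderOfSTO WellOrderingRel
  -- With these offsets all balls become sublevel sets of weighted distance at the same level `R`.
  -- The subtraction is exact for indices in `S`.
  set R := S.sup r
  set s : ι → ℕ := fun i => R - r i
  have hR : ∀ i ∈ S, (R : ℕ∞) = r i + s i := fun i hi => by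
    have : r i ≤ R := le_sup hi
    rw [← Nat.cast_add, Nat.cast_inj]
    simp only [s]
    omega
  have hmem : ∀ i ∈ S, ∀ v, v ∈ G.closedBall (c i) (r i) ↔ G.powerDist c s v i ≤ R := by
    intro i hi v
    rw [mem_closedBall, powerDist, hR i hi, ENat.add_le_add_iff_right (ENat.natCast_ne_top _)]
  -- If another site `j` were at least as good at `c i`, then `d(c i, c j) + r i ≤ r j` and the ball
  -- of `i` would lie inside that of `j`.
  have hc : ∀ i ∈ S, c i ∈ G.powerCell c s S i := by
    intro i hi
    have hii : G.powerDist c s (c i) i = s i := by rw [powerDist, edist_self, zero_add]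
    refine ⟨by rw [hii]; exact ENat.natCast_ne_top _, fun j hj => ?_⟩
    by_cases hij : i = j
    · subst hij
      exact Or.inr ⟨rfl, le_rfl⟩
    · refine Or.inl (lt_of_not_ge fun hle => hij (hS i hi j hj ?_))
      rw [hii] at hle
      refine closedBall_subset_closedBall ?_
      rw [← ENat.add_le_add_iff_right (ENat.natCast_ne_top (s j)), ← hR j hj, hR i hi]
      calc G.edist (c i) (c j) + r i + s j = G.powerDist c s (c i) j + r i := by
            rw [powerDist]; ring
        _ ≤ s i + r i := by gcongr
        _ = r i + s i := add_comm _ _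
  refine ⟨G.touching (G.powerCell c s S), fun T hT hne => ?_, fun v => ?_⟩
  · have hfree : ((G.touching (G.powerCell c s S)).induce (T : Set ι)).CompleteMinorFree t :=
      fun h => hG (h.trans (isMinor_induce_touching_powerCell hc hT))
    have : Nonempty (T : Set ι) := hne.to_subtype
    obtain ⟨i, hi⟩ := hfree.exists_card_adj_le
    refine ⟨i, i.2, le_trans ?_ hi⟩
    rw [← Set.ncard_coe_finset, ← Set.ncard_image_of_injective _ Subtype.val_injective]
    refine Set.ncard_le_ncard ?_ (Set.toFinite _)
    rintro j ⟨hj, hij⟩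
    exact ⟨⟨j, hj⟩, by simpa using hij, rfl⟩
  · have h := preconnected_induce_touching_powerCell hc v R
    have hset : {i | i ∈ S ∧ v ∈ G.closedBall (c i) (r i)} =
        {i | i ∈ S ∧ G.powerDist c s v i ≤ R} := by
      ext i
      exact and_congr_right fun hi => hmem i hi v
    rwa [hset]

/-- In a graph without `K_t` minor there are no `t` vertices of which balls cut out every pair. -/
theorem CompleteMinorFree.not_all_pairs {V : Type*} {G : SimpleGraph V} {t : ℕ}
    (hG : G.CompleteMinorFree t) (x : Fin t → V) (hx : Function.Injective x) :
    ¬ ∀ i j, i ≠ j → ∃ v r, ∀ k, x k ∈ G.closedBall v r ↔ k = i ∨ k = j := by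
  intro hpairs
  -- Ordinary Voronoi cells of the points `x k` serve as branch sets of a `K_t` minor.
  set s : Fin t → ℕ := fun _ => 0
  have hd : ∀ y k, G.powerDist x s y k = G.edist y (x k) := fun y k => by
    simp [powerDist, s]
  have hc : ∀ i ∈ univ, x i ∈ G.powerCell x s univ i := by
    intro i _
    refine ⟨by simp [hd], fun j _ => ?_⟩
    rw [hd, hd, edist_self]
    by_cases hij : i = j
    · subst hij
      simp
    · exact Or.inl (G.edist_pos_of_ne (hx.ne hij))
  refine hG (IsMinor.trans ?_ (isMinor_touching
    (fun i => connected_powerCell (hc i (mem_univ i))) fun i j hij => Set.disjoint_left.2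
      fun y hi hj => hij (eq_of_mem_powerCell (mem_univ i) (mem_univ j) hi hj)))
  refine ⟨fun i => {i}, fun i => connected_induce_singleton _ i, by simp, fun i j hij => ?_⟩
  refine ⟨i, rfl, j, rfl, ?_⟩
  replace hij : i ≠ j := hij
  obtain ⟨v, r, hvr⟩ := hpairs i j hij
  -- The sites within distance `r` of `v` are exactly `x i` and `x j`; being connected, their cells
  -- touch.
  have hpre := preconnected_induce_touching_powerCell hc v r
  have hset : {k | k ∈ univ ∧ G.powerDist x s v k ≤ r} = {i, j} := by
    ext k
    rw [Set.mem_ofPred_eq, hd, edist_comm, ← mem_closedBall, hvr]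
    simp
  rw [hset] at hpre
  have : Nontrivial ({i, j} : Set (Fin t)) :=
    ⟨⟨i, by simp⟩, ⟨j, by simp⟩, fun h => hij (congrArg Subtype.val h)⟩
  obtain ⟨⟨k, hk⟩, hadj⟩ := hpre.exists_adj_of_nontrivial ⟨i, by simp⟩
  rcases hk with rfl | rfl
  · exact absurd rfl hadj.ne
  · exact hadj

end SimpleGraph

/-! ### Set families with sparse supports -/

/-- Every subfamily of the set family `b` has a `d`-degenerate support graph: for each point the
members containing it are connected. -/
def HasSparseSupports {V ι : Type*} (b : ι → Finset V) (d : ℕ) : Prop :=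
  ∀ S : Finset ι, ∃ Q : SimpleGraph ι,
    (∀ T ⊆ S, T.Nonempty → ∃ i ∈ T, {j | j ∈ T ∧ Q.Adj i j}.ncard ≤ d) ∧
    ∀ v, (Q.induce {i | i ∈ S ∧ v ∈ b i}).Preconnected

/-- Peel off vertices of degree at most `d`: the edges at a removed vertex `i` weigh at most `d * w
i`, counted in both orders. -/
theorem sum_sum_adj_min_le {ι : Type*} [DecidableEq ι] {Q : SimpleGraph ι} [DecidableRel Q.Adj]
    {S : Finset ι} {d : ℕ}
    (hQ : ∀ T ⊆ S, T.Nonempty → ∃ i ∈ T, {j | j ∈ T ∧ Q.Adj i j}.ncard ≤ d)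
    {w : ι → ℝ} (hw : ∀ i, 0 ≤ w i) :
    ∑ i ∈ S, ∑ j ∈ S, (if Q.Adj i j then min (w i) (w j) else 0) ≤ 2 * d * ∑ i ∈ S, w i := by
  suffices h : ∀ T ⊆ S, ∑ i ∈ T, ∑ j ∈ T, (if Q.Adj i j then min (w i) (w j) else 0) ≤
      2 * d * ∑ i ∈ T, w i from h S Subset.rfl
  intro T
  induction T using Finset.strongInduction with
  | H T ih =>
  intro hTS
  rcases T.eq_empty_or_nonempty with rfl | hne
  · simp
  obtain ⟨i, hi, hdeg⟩ := hQ T hTS hne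
  have hih := ih (T.erase i) (erase_ssubset hi) ((erase_subset _ _).trans hTS)
  set g : ι → ι → ℝ := fun a b => if Q.Adj a b then min (w a) (w b) else 0 with hg
  have hsymm : ∀ a b, g a b = g b a := fun a b => by
    simp only [hg, Q.adj_comm a b, min_comm]
  have hii : g i i = 0 := by simp [hg]
  have hrow : ∑ j ∈ T.erase i, g i j ≤ d * w i := by
    calc ∑ j ∈ T.erase i, g i j ≤ ∑ j ∈ T, g i j := by
          refine sum_le_sum_of_subset_of_nonneg (erase_subset _ _) fun j _ _ => ?_
          simp only [hg]
          split_ifs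
          · exact le_min (hw _) (hw _)
          · exact le_rfl
      _ = ∑ j ∈ T with Q.Adj i j, min (w i) (w j) := by rw [sum_filter]
      _ ≤ #{j ∈ T | Q.Adj i j} • w i := sum_le_card_nsmul _ _ _ fun j _ => min_le_left _ _
      _ ≤ d * w i := by
          rw [nsmul_eq_mul]
          refine mul_le_mul_of_nonneg_right ?_ (hw i)
          rw [← Set.ncard_coe_finset, coe_filter]
          exact_mod_cast hdeg
  have hT : ∑ a ∈ T, ∑ b ∈ T, g a b =
      ∑ a ∈ T.erase i, ∑ b ∈ T.erase i, g a b + 2 * ∑ b ∈ T.erase i, g i b := by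
    have h1 : ∀ f : ι → ℝ, ∑ a ∈ T, f a = f i + ∑ a ∈ T.erase i, f a := fun f =>
      (add_sum_erase T f hi).symm
    simp only [h1, sum_add_distrib, hii, fun a => hsymm a i]
    ring
  have hw' := add_sum_erase T w hi
  rw [hT, ← hw']
  linarith

/-- A connected graph on two or more vertices has no isolated vertex; the summand `1` covers a
single vertex. -/
theorem card_le_one_add_sum_adj {ι : Type*} {Q : SimpleGraph ι} [DecidableRel Q.Adj]
    {D : Finset ι} (hQ : (Q.induce (D : Set ι)).Preconnected) :
    (#D : ℝ) ≤ 1 + ∑ i ∈ D, ∑ j ∈ D, if Q.Adj i j then 1 else 0 := by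
  by_cases hD : #D ≤ 1
  · have h1 : (#D : ℝ) ≤ 1 := by exact_mod_cast hD
    have h2 : (0 : ℝ) ≤ ∑ i ∈ D, ∑ j ∈ D, if Q.Adj i j then 1 else 0 := by positivity
    linarith
  · have : Nontrivial (D : Set ι) := (one_lt_card_iff_nontrivial.1 (not_le.1 hD)).coe_sort
    have h1 : (#D : ℝ) ≤ ∑ i ∈ D, ∑ j ∈ D, if Q.Adj i j then 1 else 0 := by
      rw [card_eq_sum_ones, Nat.cast_sum]
      refine sum_le_sum fun i hi => ?_
      obtain ⟨j, hij⟩ := hQ.exists_adj_of_nontrivial ⟨i, hi⟩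
      have hij' : Q.Adj i j := hij
      have := single_le_sum (f := fun j => if Q.Adj i j then (1 : ℝ) else 0) (s := D)
        (fun j _ => by positivity) j.2
      simpa [hij'] using this
    linarith

/-! ### Independent random sampling -/

section Bernoulli

theorem one_sub_sum_le_prod_one_sub {ι : Type*} [DecidableEq ι] {p : ι → ℝ} (h0 : ∀ i, 0 ≤ p i) (h1 : ∀ i, p i ≤ 1)
    (s : Finset ι) : 1 - ∑ i ∈ s, p i ≤ ∏ i ∈ s, (1 - p i) := by
  induction s using Finset.induction_on with
  | empty => simp
  | insert a s ha ih =>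
    rw [sum_insert ha, prod_insert ha]
    have h2 : ∏ i ∈ s, (1 - p i) ≤ 1 :=
      prod_le_one (fun i _ => sub_nonneg.2 (h1 i)) fun i _ => by linarith [h0 i]
    nlinarith [h0 a, h1 a]

variable {ι : Type*} [Fintype ι] [DecidableEq ι]

/-- The probability of `S` when each `i` is chosen independently with probability `p i`. -/
noncomputable def bernoulliWeight (p : ι → ℝ) (S : Finset ι) : ℝ :=
  (∏ i ∈ S, p i) * ∏ i ∈ Sᶜ, (1 - p i)

theorem bernoulliWeight_nonneg {p : ι → ℝ} (h0 : ∀ i, 0 ≤ p i) (h1 : ∀ i, p i ≤ 1)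
    (S : Finset ι) : 0 ≤ bernoulliWeight p S :=
  mul_nonneg (prod_nonneg fun i _ => h0 i) (prod_nonneg fun i _ => sub_nonneg.2 (h1 i))

theorem sum_bernoulliWeight_mem (p : ι → ℝ) (i : ι) :
    ∑ S : Finset ι, bernoulliWeight p S * (if i ∈ S then 1 else 0) = p i := by
  -- Expanding the product over subsets gives the total probability; replacing `1 - p i` by zero
  -- keeps exactly the subsets containing `i`.
  have h := Fintype.prod_add p (fun k => if k = i then 0 else 1 - p k)
  have hl : ∏ k, (p k + if k = i then 0 else 1 - p k) = p i := by
    rw [prod_eq_single i]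
    · simp
    · intro k _ hk
      simp [hk]
    · simp
  rw [← hl, h]
  refine sum_congr rfl fun S _ => ?_
  by_cases hi : i ∈ S
  · rw [if_pos hi, mul_one, bernoulliWeight]
    congr 1
    refine prod_congr rfl fun k hk => ?_
    rw [if_neg]
    rintro rfl
    exact mem_compl.1 hk hi
  · rw [if_neg hi, mul_zero, prod_eq_zero (i := i) (s := Sᶜ) (mem_compl.2 hi) (by simp), mul_zero]

theorem le_sum_bernoulliWeight_pair {p : ι → ℝ} (h0 : ∀ i, 0 ≤ p i) (h1 : ∀ i, p i ≤ 1)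
    {i j : ι} (hij : i ≠ j) (D : Finset ι) :
    p i * p j * (1 - ∑ k ∈ D, p k) ≤ ∑ S : Finset ι, bernoulliWeight p S *
      (if i ∈ S ∧ j ∈ S ∧ ∀ k ∈ S, k ∈ D → k = i ∨ k = j then 1 else 0) := by
  -- The zeroed factors keep only the samples that contain `i` and `j` and no other element of `D`;
  -- a union bound then estimates the remaining product.
  have h := Fintype.prod_add (fun k => if k ∈ D ∧ ¬ (k = i ∨ k = j) then 0 else p k)
    (fun k => if k = i ∨ k = j then 0 else 1 - p k)
  have hl : ∏ k, ((if k ∈ D ∧ ¬ (k = i ∨ k = j) then 0 else p k) +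
      (if k = i ∨ k = j then 0 else 1 - p k)) =
      p i * p j * ∏ k ∈ D with ¬ (k = i ∨ k = j), (1 - p k) := by
    have : ∀ k, ((if k ∈ D ∧ ¬ (k = i ∨ k = j) then 0 else p k) +
        (if k = i ∨ k = j then 0 else 1 - p k)) =
        (if k = i then p k else 1) * (if k = j then p k else 1) *
          (if k ∈ D.filter (fun k => ¬ (k = i ∨ k = j)) then 1 - p k else 1) := by
      intro k
      by_cases hi : k = i
      · have hj : k ≠ j := fun h => hij (hi.symm.trans h)
        simp [hi, hij]
      · by_cases hj : k = j
        · simp [hj, hij.symm]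
        · by_cases hD : k ∈ D <;> simp [hi, hj, hD]
    simp_rw [this, prod_mul_distrib]
    simp only [prod_ite_eq', mem_univ, if_true, prod_ite_mem, univ_inter]
  have hle : p i * p j * (1 - ∑ k ∈ D, p k) ≤
      p i * p j * ∏ k ∈ D with ¬ (k = i ∨ k = j), (1 - p k) := by
    refine mul_le_mul_of_nonneg_left ?_ (mul_nonneg (h0 i) (h0 j))
    refine le_trans ?_ (one_sub_sum_le_prod_one_sub h0 h1 _)
    have := sum_le_sum_of_subset_of_nonneg (f := p)
      (filter_subset (fun k => ¬ (k = i ∨ k = j)) D) fun k _ _ => h0 k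
    linarith
  refine hle.trans (le_of_eq ?_)
  rw [← hl, h]
  refine sum_congr rfl fun S _ => ?_
  by_cases hS : i ∈ S ∧ j ∈ S ∧ ∀ k ∈ S, k ∈ D → k = i ∨ k = j
  · rw [if_pos hS, mul_one, bernoulliWeight]
    congr 1
    · refine prod_congr rfl fun k hk => ?_
      rw [if_neg fun h => h.2 (hS.2.2 k hk h.1)]
    · refine prod_congr rfl fun k hk => ?_
      rw [if_neg]
      rintro (rfl | rfl)
      · exact mem_compl.1 hk hS.1
      · exact mem_compl.1 hk hS.2.1
  · rw [if_neg hS, mul_zero]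
    by_cases hi : i ∈ S
    · by_cases hj : j ∈ S
      · have : ∃ k ∈ S, k ∈ D ∧ ¬ (k = i ∨ k = j) := by
          by_contra! hcon
          exact hS ⟨hi, hj, fun k hk hkD => by_contra fun h' => absurd (hcon k hk hkD) (by tauto)⟩
        obtain ⟨k, hk, hkD⟩ := this
        rw [prod_eq_zero (i := k) hk (by rw [if_pos hkD]), zero_mul]
      · rw [prod_eq_zero (i := j) (s := Sᶜ) (mem_compl.2 hj) (by simp), mul_zero]
    · rw [prod_eq_zero (i := i) (s := Sᶜ) (mem_compl.2 hi) (by simp), mul_zero]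

end Bernoulli

/-! ### From fractional to integral matchings -/

section FractionalMatching

variable {V ι : Type*}

/-- Pairs meeting in a point that no other member contains are adjacent in any support. -/
theorem adj_of_preconnected {b : ι → Finset V} {S : Finset ι} {Q : SimpleGraph ι} {v : V}
    (hQ : (Q.induce {i | i ∈ S ∧ v ∈ b i}).Preconnected) {i j : ι} (hij : i ≠ j) (hi : i ∈ S)
    (hj : j ∈ S) (hvi : v ∈ b i) (hvj : v ∈ b j) (h : ∀ k ∈ S, v ∈ b k → k = i ∨ k = j) :
    Q.Adj i j := by
  have : Nontrivial {i | i ∈ S ∧ v ∈ b i} :=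
    ⟨⟨i, hi, hvi⟩, ⟨j, hj, hvj⟩, fun h => hij (congrArg Subtype.val h)⟩
  obtain ⟨⟨k, hk⟩, hadj⟩ := hQ.exists_adj_of_nontrivial ⟨i, hi, hvi⟩
  rcases h k hk.1 hk.2 with rfl | rfl
  · exact absurd rfl hadj.ne
  · exact hadj

variable [DecidableEq V]

/-- In a fractional matching of a family with sparse supports, the pairs of intersecting members
have linear total weight. -/
theorem HasSparseSupports.sum_mul_le [Fintype ι] {b : ι → Finset V} {d : ℕ}
    (hb : HasSparseSupports b d) (hne : ∀ i, (b i).Nonempty) {w : ι → ℝ} (hw : ∀ i, 0 ≤ w i)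
    (hdepth : ∀ v, ∑ i with v ∈ b i, w i ≤ 1) :
    ∑ i, ∑ j, (if Disjoint (b i) (b j) then 0 else w i * w j) ≤ (8 * d + 1) * ∑ i, w i := by
  classical
  have hw1 : ∀ i, w i ≤ 1 := by
    intro i
    obtain ⟨v, hv⟩ := hne i
    exact (single_le_sum (f := w) (fun k _ => hw k) (by simpa using hv)).trans (hdepth v)
  -- Halving makes the expected number of sampled members through any point at most `1 / 2`, so a
  -- union bound leaves a factor `1 / 2` for no third member being there.
  set p : ι → ℝ := fun i => w i / 2 with hp
  have hp0 : ∀ i, 0 ≤ p i := fun i => by simp only [hp]; linarith [hw i]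
  have hp1 : ∀ i, p i ≤ 1 := fun i => by simp only [hp]; linarith [hw1 i]
  have hpt : ∀ i j, ∃ v, ¬ Disjoint (b i) (b j) → v ∈ b i ∧ v ∈ b j := by
    intro i j
    by_cases h : Disjoint (b i) (b j)
    · exact ⟨(hne i).choose, fun h' => absurd h h'⟩
    · obtain ⟨v, hv, hv'⟩ := not_disjoint_iff.1 h
      exact ⟨v, fun _ => ⟨hv, hv'⟩⟩
  choose x hx using hpt
  let X : Finset ι → ι → ι → Prop := fun S i j =>
    i ∈ S ∧ j ∈ S ∧ ∀ k ∈ S, k ∈ ({k | x i j ∈ b k} : Finset ι) → k = i ∨ k = j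
  let I : ι → ι → Prop := fun i j => i ≠ j ∧ ¬ Disjoint (b i) (b j)
  -- A pair isolated by `S` at its witness point `x i j` is an edge of the support of `S`, which has
  -- at most `2 * d * #S` ordered adjacent pairs. Averaging over random `S` gives `hE`.
  have hcount : ∀ S : Finset ι,
      ∑ i, ∑ j, (if I i j then (if X S i j then (1 : ℝ) else 0) else 0) ≤
        2 * d * ∑ i, (if i ∈ S then (1 : ℝ) else 0) := by
    intro S
    obtain ⟨Q, hQ, hQc⟩ := hb S
    have h1 := sum_sum_adj_min_le hQ (w := fun _ => 1) (fun _ => zero_le_one)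
    simp only [min_self] at h1
    calc ∑ i, ∑ j, (if I i j then (if X S i j then (1 : ℝ) else 0) else 0)
        ≤ ∑ i, ∑ j, (if i ∈ S then (if j ∈ S then (if Q.Adj i j then 1 else 0) else 0) else 0) := by
          refine sum_le_sum fun i _ => sum_le_sum fun j _ => ?_
          by_cases hI : I i j
          · by_cases hX : X S i j
            · have hadj : Q.Adj i j := adj_of_preconnected (hQc (x i j)) hI.1 hX.1 hX.2.1
                (hx i j hI.2).1 (hx i j hI.2).2 fun k hk hk' => hX.2.2 k hk (by simpa using hk')
              simp [hI, hX, hX.1, hX.2.1, hadj]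
            · rw [if_pos hI, if_neg hX]
              positivity
          · rw [if_neg hI]
            positivity
      _ = ∑ i ∈ S, ∑ j ∈ S, (if Q.Adj i j then (1 : ℝ) else 0) := by
          simp only [sum_ite_irrel, sum_const_zero, sum_ite_mem, univ_inter]
      _ ≤ 2 * d * ∑ i ∈ S, (1 : ℝ) := h1
      _ = _ := by rw [← sum_filter, filter_univ_mem]
  have hE : ∑ i, ∑ j, (if I i j then p i * p j * (1 / 2) else 0) ≤ 2 * d * ∑ i, p i := by
    calc ∑ i, ∑ j, (if I i j then p i * p j * (1 / 2) else 0)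
        ≤ ∑ i, ∑ j, (if I i j then ∑ S : Finset ι, bernoulliWeight p S *
            (if X S i j then 1 else 0) else 0) := by
          refine sum_le_sum fun i _ => sum_le_sum fun j _ => ?_
          by_cases hI : I i j
          · rw [if_pos hI, if_pos hI]
            refine le_trans ?_ (le_sum_bernoulliWeight_pair hp0 hp1 hI.1 _)
            refine mul_le_mul_of_nonneg_left ?_ (mul_nonneg (hp0 i) (hp0 j))
            have := hdepth (x i j)
            simp only [hp]
            rw [← sum_div]
            linarith
          · rw [if_neg hI, if_neg hI]
      _ = ∑ S : Finset ι, bernoulliWeight p S *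
            ∑ i, ∑ j, (if I i j then (if X S i j then (1 : ℝ) else 0) else 0) := by
          simp_rw [mul_sum]
          rw [sum_comm]
          conv_rhs => rw [sum_comm]
          rw [sum_comm]
          refine sum_congr rfl fun i _ => ?_
          rw [sum_comm]
          refine sum_congr rfl fun j _ => ?_
          by_cases hI : I i j <;> simp [hI]
      _ ≤ ∑ S : Finset ι, bernoulliWeight p S * (2 * d * ∑ i, (if i ∈ S then (1 : ℝ) else 0)) :=
          sum_le_sum fun S _ =>
            mul_le_mul_of_nonneg_left (hcount S) (bernoulliWeight_nonneg hp0 hp1 S)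
      _ = 2 * d * ∑ i, ∑ S : Finset ι, bernoulliWeight p S * (if i ∈ S then (1 : ℝ) else 0) := by
          rw [sum_comm, mul_sum]
          refine sum_congr rfl fun S _ => ?_
          rw [← mul_sum]
          ring
      _ = _ := by simp_rw [sum_bernoulliWeight_mem]
  -- Here `8` comes from `w i * w j = 4 * (p i * p j)` and the probability `1 / 2`; the diagonal is
  -- bounded by `w i ^ 2 ≤ w i`.
  have hsplit : ∑ i, ∑ j, (if Disjoint (b i) (b j) then 0 else w i * w j) ≤
      ∑ i, ∑ j, ((if I i j then 8 * (p i * p j * (1 / 2)) else 0) +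
        (if i = j then w i else 0)) := by
    refine sum_le_sum fun i _ => sum_le_sum fun j _ => ?_
    by_cases hd : Disjoint (b i) (b j)
    · rw [if_pos hd]
      have := hw i
      have h1 := hp0 i
      have h2 := hp0 j
      positivity
    · by_cases hij : i = j
      · subst hij
        have : ¬ I i i := fun h => h.1 rfl
        rw [if_neg hd, if_neg this, if_pos rfl]
        nlinarith [hw i, hw1 i]
      · have : I i j := ⟨hij, hd⟩
        rw [if_neg hd, if_pos this, if_neg hij]
        simp only [hp]
        linarith
  refine hsplit.trans ?_
  have h8 : ∑ i, ∑ j, (if I i j then 8 * (p i * p j * (1 / 2)) else 0) =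
      8 * ∑ i, ∑ j, (if I i j then p i * p j * (1 / 2) else 0) := by
    simp_rw [mul_sum, mul_ite, mul_zero]
  have hpw : ∑ i, p i = (∑ i, w i) / 2 := by rw [sum_div]
  simp_rw [sum_add_distrib]
  rw [h8]
  simp only [sum_ite_eq, mem_univ, if_true]
  rw [hpw] at hE
  linarith

/-- A greedy selection of disjoint members. -/
theorem exists_disjoint_of_sum_mul_le [DecidableEq ι] {b : ι → Finset V}
    (hne : ∀ i, (b i).Nonempty) {w : ι → ℝ} (hw : ∀ i, 0 ≤ w i) {C : ℝ}
    (h : ∀ F : Finset ι, ∑ i ∈ F, ∑ j ∈ F, (if Disjoint (b i) (b j) then 0 else w i * w j) ≤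
      C * ∑ i ∈ F, w i) (F : Finset ι) :
    ∃ M ⊆ F, (∀ i ∈ M, ∀ j ∈ M, i ≠ j → Disjoint (b i) (b j)) ∧ ∑ i ∈ F, w i ≤ C * #M := by
  induction F using Finset.strongInduction with
  | H F ih =>
  rcases (sum_nonneg fun i (_ : i ∈ F) => hw i).eq_or_lt with h0 | hpos
  · exact ⟨∅, empty_subset _, by simp, by simp [← h0]⟩
  -- By averaging, some member meets members of total weight at most `C`. Select it and discard
  -- those.
  obtain ⟨i, hi, hrow⟩ : ∃ i ∈ F, ∑ j ∈ F, (if Disjoint (b i) (b j) then 0 else w j) ≤ C := by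
    by_contra! hcon
    have hlt : ∑ i ∈ F, w i * C <
        ∑ i ∈ F, w i * ∑ j ∈ F, (if Disjoint (b i) (b j) then 0 else w j) := by
      obtain ⟨i, hi, hwi⟩ := exists_lt_of_sum_lt (s := F) (f := fun _ => 0) (g := w)
        (by simpa using hpos)
      exact sum_lt_sum (fun j hj => mul_le_mul_of_nonneg_left (hcon j hj).le (hw j))
        ⟨i, hi, mul_lt_mul_of_pos_left (hcon i hi) hwi⟩
    have hF := h F
    simp_rw [mul_sum, mul_ite, mul_zero] at hlt
    rw [← sum_mul, mul_comm] at hlt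
    exact absurd hF (not_le.2 hlt)
  have hself : ¬ Disjoint (b i) (b i) := fun hd => (hne i).ne_empty (disjoint_self.1 hd)
  obtain ⟨M, hMF, hM, hcard⟩ := ih (F.filter fun j => Disjoint (b i) (b j))
    (filter_ssubset.2 ⟨i, hi, hself⟩)
  have hMd : ∀ j ∈ M, Disjoint (b i) (b j) := fun j hj => (mem_filter.1 (hMF hj)).2
  have hiM : i ∉ M := fun h => hself (hMd i h)
  refine ⟨insert i M, insert_subset hi (hMF.trans (filter_subset _ _)), ?_, ?_⟩
  · intro j hj k hk hjk
    rcases mem_insert.1 hj with hj' | hj' <;> rcases mem_insert.1 hk with hk' | hk'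
    · exact absurd (hj'.trans hk'.symm) hjk
    · exact hj' ▸ hMd k hk'
    · exact hk' ▸ (hMd j hj').symm
    · exact hM j hj' k hk' hjk
  · rw [card_insert_of_notMem hiM, Nat.cast_add, Nat.cast_one, mul_add, mul_one]
    have hs : ∑ j ∈ F, w j = ∑ j ∈ F with Disjoint (b i) (b j), w j +
        ∑ j ∈ F, (if Disjoint (b i) (b j) then 0 else w j) := by
      rw [sum_filter, ← sum_add_distrib]
      refine sum_congr rfl fun j _ => ?_
      split_ifs <;> simp
    linarith

/-- The integrality gap of matchings: in a family with sparse supports, a fractional matching of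
weight `W` yields `W / (8 d + 1)` disjoint members. -/
theorem HasSparseSupports.exists_disjoint [Fintype ι] {b : ι → Finset V} {d : ℕ}
    (hb : HasSparseSupports b d) (hne : ∀ i, (b i).Nonempty) {w : ι → ℝ} (hw : ∀ i, 0 ≤ w i)
    (hdepth : ∀ v, ∑ i with v ∈ b i, w i ≤ 1) :
    ∃ M : Finset ι, (∀ i ∈ M, ∀ j ∈ M, i ≠ j → Disjoint (b i) (b j)) ∧
      ∑ i, w i ≤ (8 * d + 1) * #M := by
  classical
  have key : ∀ F : Finset ι, ∑ i ∈ F, ∑ j ∈ F,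
      (if Disjoint (b i) (b j) then 0 else w i * w j) ≤ (8 * d + 1) * ∑ i ∈ F, w i := by
    intro F
    have h := hb.sum_mul_le hne (w := fun i => if i ∈ F then w i else 0)
      (fun i => by split_ifs <;> simp [hw]) (fun v => (sum_le_sum fun i _ => by
        split_ifs <;> simp [hw]).trans (hdepth v))
    have hl : ∑ i ∈ F, ∑ j ∈ F, (if Disjoint (b i) (b j) then 0 else w i * w j) =
        ∑ i, ∑ j, (if Disjoint (b i) (b j) then 0 else
          (if i ∈ F then w i else 0) * (if j ∈ F then w j else 0)) := by
      rw [← filter_univ_mem F, sum_filter]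
      refine sum_congr rfl fun i _ => ?_
      rw [sum_filter]
      by_cases hi : i ∈ F
      · simp only [filter_univ_mem, hi, if_true]
        refine sum_congr rfl fun j _ => ?_
        by_cases hj : j ∈ F <;> simp [hj]
      · simp [hi]
    rw [hl, ← filter_univ_mem F, sum_filter]
    simpa only [filter_univ_mem] using h
  obtain ⟨M, -, hM, hcard⟩ := exists_disjoint_of_sum_mul_le hne hw key univ
  exact ⟨M, hM, hcard⟩

end FractionalMatching

/-! ### Duality -/

/-- Minimax for the incidence game of a set family: either some probability vector on the points
gives all members weight at least `l`, or some probability vector on the members covers each point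
with weight less than `l`. -/
theorem exists_weights_or_exists_weights {V ι : Type*} [Fintype V] [Nonempty V] [Fintype ι]
    [DecidableEq V] (b : ι → Finset V) (l : ℝ) :
    (∃ μ : V → ℝ, (∀ v, 0 ≤ μ v) ∧ ∑ v, μ v = 1 ∧ ∀ i, l ≤ ∑ v ∈ b i, μ v) ∨
    ∃ w : ι → ℝ, (∀ i, 0 ≤ w i) ∧ ∑ i, w i = 1 ∧ ∀ v, ∑ i with v ∈ b i, w i < l := by
  classical
  refine or_iff_not_imp_left.2 fun hno => ?_
  let L : (V → ℝ) →ₗ[ℝ] (ι → ℝ) :=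
    LinearMap.pi fun i => ∑ v ∈ b i, LinearMap.proj v
  have hL : ∀ μ i, L μ i = ∑ v ∈ b i, μ v := fun μ i => by simp [L]
  -- If no `μ` works, the compact convex set of achievable weight vectors misses the orthant of
  -- vectors at least `l`; a separating functional supplies `w`.
  have hdisj : Disjoint (L '' stdSimplex ℝ V) (Set.Ici fun _ => l) := by
    rw [Set.disjoint_left]
    rintro _ ⟨μ, hμ, rfl⟩ h
    exact hno ⟨μ, hμ.1, hμ.2, fun i => (h i).trans_eq (hL μ i)⟩
  obtain ⟨f, u, u', hlt, huu, hgt⟩ := geometric_hahn_banach_compact_closed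
    ((convex_stdSimplex ℝ V).linear_image L)
    ((isCompact_stdSimplex ℝ V).image L.continuous_of_finiteDimensional)
    (convex_Ici _) isClosed_Ici hdisj
  set w : ι → ℝ := fun i => f (Pi.single i 1) with hw
  have hf : ∀ x, f x = ∑ i, x i * w i := by
    intro x
    conv_lhs => rw [pi_eq_sum_univ' x]
    simp [hw]
  have hpoint : ∀ v, ∑ i with v ∈ b i, w i < u := by
    intro v
    have := hlt _ ⟨_, single_mem_stdSimplex ℝ v, rfl⟩
    rw [hf] at this
    refine lt_of_eq_of_lt ?_ this
    rw [sum_filter]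
    refine sum_congr rfl fun i _ => ?_
    rw [hL]
    simp [Pi.single_apply]
  have hconst : u' < l * ∑ i, w i := by
    have := hgt _ (Set.mem_Ici.2 le_rfl)
    rwa [hf, ← mul_sum] at this
  -- Were `w i` negative, moving by `s` in direction `i` would stay in the orthant but bring the
  -- functional down to exactly `u'`.
  have hw0 : ∀ i, 0 ≤ w i := by
    intro i
    by_contra! hneg
    set s : ℝ := (l * ∑ i, w i - u') / (-w i)
    have hs : 0 ≤ s := div_nonneg (by linarith) (by linarith)
    have := hgt ((fun _ => l) + Pi.single i s) (by
      refine Set.mem_Ici.2 fun k => ?_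
      simp only [Pi.add_apply, Pi.single_apply]
      split_ifs <;> linarith)
    rw [hf] at this
    simp only [Pi.add_apply, add_mul, sum_add_distrib, ← mul_sum, Pi.single_apply, ite_mul,
      zero_mul, sum_ite_eq', mem_univ, if_true] at this
    have h2 : s * w i = -(l * ∑ i, w i - u') := by
      simp only [s]
      field_simp [hneg.ne]
    linarith
  have hpos : 0 < ∑ i, w i := by
    refine (sum_nonneg fun i _ => hw0 i).lt_of_ne fun h0 => ?_
    have hz := (sum_eq_zero_iff_of_nonneg fun i _ => hw0 i).1 h0.symm
    obtain ⟨v⟩ := ‹Nonempty V›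
    have h1 := hpoint v
    rw [sum_eq_zero fun i _ => hz i (mem_univ i)] at h1
    rw [← h0, mul_zero] at hconst
    linarith
  refine ⟨fun i => w i / ∑ k, w k, fun i => div_nonneg (hw0 i) hpos.le, ?_, fun v => ?_⟩
  · rw [← sum_div, div_self hpos.ne']
  · rw [← sum_div, div_lt_iff₀ hpos]
    linarith [hpoint v]

/-- In a family with sparse supports and at most `n` pairwise disjoint members there is a
probability vector giving each member weight at least of order `1 / n`. -/
theorem HasSparseSupports.exists_weights {V ι : Type*} [Fintype V] [Nonempty V] [Fintype ι]
    [DecidableEq V] {b : ι → Finset V} {d n : ℕ} (hb : HasSparseSupports b d)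
    (hne : ∀ i, (b i).Nonempty)
    (hn : ∀ M : Finset ι, (∀ i ∈ M, ∀ j ∈ M, i ≠ j → Disjoint (b i) (b j)) → #M ≤ n) :
    ∃ μ : V → ℝ, (∀ v, 0 ≤ μ v) ∧ ∑ v, μ v = 1 ∧
      ∀ i, 1 / ((8 * d + 1) * n + 1 : ℝ) ≤ ∑ v ∈ b i, μ v := by
  set K : ℝ := (8 * d + 1) * n + 1 with hK
  have hK0 : 0 < K := by positivity
  refine (exists_weights_or_exists_weights b (1 / K)).resolve_right ?_
  -- Scaled by `K`, such a `w` is a fractional matching of weight `K`, whence `K ≤ (8 * d + 1) * n =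
  -- K - 1`.
  rintro ⟨w, hw0, hw1, hw⟩
  obtain ⟨M, hM, hle⟩ := hb.exists_disjoint hne (w := fun i => K * w i)
    (fun i => mul_nonneg hK0.le (hw0 i)) (fun v => by
      rw [← mul_sum, mul_comm, ← le_div_iff₀ hK0]
      exact (hw v).le)
  rw [← mul_sum, hw1, mul_one] at hle
  have : ((8 * d + 1) * #M : ℝ) ≤ (8 * d + 1) * n := by
    gcongr
    exact hn M hM
  linarith

/-! ### Vapnik–Chervonenkis dimension and `ε`-nets -/

/-- No `t` points have all of their pairs cut out by members of the set family `b`. -/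
def CutsNoPairs {V ι : Type*} (b : ι → Finset V) (t : ℕ) : Prop :=
  ∀ x : Fin t → V, Function.Injective x →
    ¬ ∀ i j, i ≠ j → ∃ a, ∀ k, x k ∈ b a ↔ k = i ∨ k = j

namespace CutsNoPairs

variable {V ι : Type*} {b : ι → Finset V} {t : ℕ}

theorem comp {κ : Type*} (hb : CutsNoPairs b t) (f : κ → ι) : CutsNoPairs (b ∘ f) t :=
  fun x hx h => hb x hx fun i j hij => (h i j hij).imp' f fun _ h => h

theorem pos (hb : CutsNoPairs b t) : 0 < t := by
  rcases Nat.eq_zero_or_pos t with rfl | h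
  · exact absurd (fun i => i.elim0) (hb (fun i => i.elim0) fun i => i.elim0)
  · exact h

open Classical in
/-- The traces of the family on a finite labelled point set. -/
noncomputable def traces {P : Type*} [Fintype P] (b : ι → Finset V) (z : P → V) :
    Finset (Finset P) :=
  {T | ∃ a, T = ({p | z p ∈ b a} : Finset P)}

/-- In a shattered set of `t` labels, the singleton traces force the labelled points to be distinct,
and the two-element traces then cut out all pairs. -/
theorem card_lt_of_shatters {P : Type*} [Fintype P] [DecidableEq P] (hb : CutsNoPairs b t)
    (z : P → V) {s : Finset P} (hs : (traces b z).Shatters s) : #s < t := by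
  classical
  by_contra! hcard
  obtain ⟨s', hs', hc⟩ := exists_subset_card_eq hcard
  replace hs := hs.mono_right hs'
  have htr : ∀ u ⊆ s', ∃ a, ∀ p ∈ s', z p ∈ b a ↔ p ∈ u := by
    intro u hu
    obtain ⟨T, hT, hTu⟩ := hs hu
    obtain ⟨a, rfl⟩ := (mem_filter.1 hT).2
    refine ⟨a, fun p hp => ?_⟩
    rw [← hTu]
    simp [hp]
  let e : Fin t ≃ s' := (s'.equivFinOfCardEq hc).symm
  refine hb (fun i => z (e i)) (fun i j hij => ?_) fun i j _ => ?_
  · obtain ⟨a, ha⟩ := htr {(e i).1} (by simp)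
    have h1 := ha (e i) (e i).2
    have h2 := ha (e j) (e j).2
    simp only [mem_singleton, iff_true] at h1 h2
    exact (e.injective (Subtype.ext (h2.1 ((congrArg (· ∈ b a) hij).mp h1)))).symm
  · obtain ⟨a, ha⟩ := htr {(e i).1, (e j).1} (by simp [insert_subset_iff])
    refine ⟨a, fun k => ?_⟩
    rw [ha (e k) (e k).2, mem_insert, mem_singleton, ← Subtype.ext_iff, ← Subtype.ext_iff,
      e.injective.eq_iff, e.injective.eq_iff]

/-- The Sauer–Shelah lemma, with each binomial coefficient bounded crudely. -/
theorem card_traces_le {P : Type*} [Fintype P] (hb : CutsNoPairs b t) (z : P → V) :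
    #(traces b z) ≤ t * (Fintype.card P + 1) ^ t := by
  classical
  have hvc : (traces b z).vcDim < t := by
    rw [vcDim, Finset.sup_lt_iff hb.pos]
    exact fun s hs => hb.card_lt_of_shatters z (mem_shatterer.1 hs)
  calc #(traces b z) ≤ #(traces b z).shatterer := card_le_card_shatterer _
    _ ≤ ∑ k ∈ Iic (traces b z).vcDim, (Fintype.card P).choose k := card_shatterer_le_sum_vcDim
    _ ≤ ∑ k ∈ range t, (Fintype.card P).choose k := by
        refine sum_le_sum_of_subset fun k hk => ?_
        rw [mem_Iic] at hk
        exact mem_range.2 (hk.trans_lt hvc)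
    _ ≤ ∑ k ∈ range t, (Fintype.card P + 1) ^ t := by
        refine sum_le_sum fun k hk => (Nat.choose_le_pow _ k).trans ?_
        exact (Nat.pow_le_pow_left (Nat.le_succ _) k).trans
          (Nat.pow_le_pow_right (Nat.succ_pos _) (mem_range.1 hk).le)
    _ = t * (Fintype.card P + 1) ^ t := by rw [sum_const, card_range, smul_eq_mul]

section DoubleSampling

variable [Fintype V]

theorem sum_prod_eq_one {μ : V → ℝ} (h1 : ∑ v, μ v = 1) (m : ℕ) :
    ∑ x : Fin m → V, ∏ k, μ (x k) = 1 := by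
  classical
  rw [← Fintype.piFinset_univ, ← prod_univ_sum (fun _ : Fin m => (univ : Finset V))
    (fun _ v => μ v)]
  simp [h1]

/-- Double sampling: if each `m` points are avoided by some member of the family, whereas all
members have weight at least `δ`, then `(1 + δ) ^ m` is at most the number of traces on `2 m`
points. -/
theorem one_add_pow_le (hb : CutsNoPairs b t) {μ : V → ℝ} (h0 : ∀ v, 0 ≤ μ v)
    (h1 : ∑ v, μ v = 1) {δ : ℝ} (hδ : 0 ≤ δ) (hle : ∀ a, δ ≤ ∑ v ∈ b a, μ v) {m : ℕ}
    (hm : ∀ x : Fin m → V, ∃ a, ∀ k, x k ∉ b a) :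
    (1 + δ) ^ m ≤ t * (2 * m + 1) ^ t := by
  classical
  choose A hA using hm
  let W : (Fin m → V) → ℝ := fun x => ∏ k, μ (x k)
  have hW0 : ∀ x, 0 ≤ W x := fun x => prod_nonneg fun k _ => h0 _
  have hW1 : ∑ x, W x = 1 := sum_prod_eq_one h1 m
  -- For independent samples `x`, `y`, this is `2` to the number of points of `y` in the member `A
  -- x` that `x` misses. Its mean over `y` is at least `(1 + δ) ^ m`. The mean is unchanged by the
  -- coordinate swaps `sw σ`, which give the upper bound.
  let g : (Fin m → V) × (Fin m → V) → ℝ := fun p => ∏ k, if p.2 k ∈ b (A p.1) then 2 else 1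
  let sw : (Fin m → Bool) → (Fin m → V) × (Fin m → V) → (Fin m → V) × (Fin m → V) := fun σ p =>
    (fun k => if σ k then p.2 k else p.1 k, fun k => if σ k then p.1 k else p.2 k)
  have hsw : ∀ σ, Function.Involutive (sw σ) := by
    rintro σ ⟨x, y⟩
    simp only [sw, Prod.mk.injEq]
    constructor <;> funext k <;> by_cases hk : σ k = true <;> simp [hk]
  have hlow : (1 + δ) ^ m ≤ ∑ p : (Fin m → V) × (Fin m → V), W p.1 * W p.2 * g p := by
    rw [Fintype.sum_prod_type]
    calc (1 + δ) ^ m = ∑ x, W x * (1 + δ) ^ m := by rw [← sum_mul, hW1, one_mul]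
      _ ≤ _ := sum_le_sum fun x _ => ?_
    have hin : ∑ y : Fin m → V, W y * g (x, y) = (1 + ∑ v ∈ b (A x), μ v) ^ m := by
      have : ∀ y : Fin m → V, W y * g (x, y) =
          ∏ k, (μ (y k) * if y k ∈ b (A x) then 2 else 1) := fun y => prod_mul_distrib.symm
      simp_rw [this]
      rw [← Fintype.piFinset_univ, ← prod_univ_sum (fun _ : Fin m => (univ : Finset V))
        (fun _ v => μ v * if v ∈ b (A x) then 2 else 1), prod_const, card_univ, Fintype.card_fin]
      have hv : ∀ v, (μ v * if v ∈ b (A x) then 2 else 1) =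
          μ v + if v ∈ b (A x) then μ v else 0 := by
        intro v
        split_ifs <;> ring
      simp_rw [hv, sum_add_distrib, h1, sum_ite_mem, univ_inter]
    simp_rw [mul_assoc]
    rw [← mul_sum, hin]
    refine mul_le_mul_of_nonneg_left ?_ (hW0 x)
    exact pow_le_pow_left₀ (by linarith) (by linarith [hle (A x)]) m
  have hinv : ∀ σ, ∑ p : (Fin m → V) × (Fin m → V), W p.1 * W p.2 * g (sw σ p) =
      ∑ p : (Fin m → V) × (Fin m → V), W p.1 * W p.2 * g p := by
    intro σ
    rw [← Equiv.sum_comp (hsw σ).toPerm (fun p => W p.1 * W p.2 * g p)]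
    refine sum_congr rfl fun p _ => ?_
    congr 1
    simp only [W, ← prod_mul_distrib, Function.Involutive.coe_toPerm, sw]
    refine prod_congr rfl fun k _ => ?_
    by_cases hk : σ k = true <;> simp [hk, mul_comm]
  have hup : ∀ p : (Fin m → V) × (Fin m → V),
      ∑ σ, g (sw σ p) ≤ (t * (2 * m + 1) ^ t : ℝ) * 2 ^ m := by
    rintro ⟨x, y⟩
    let z : Fin m × Bool → V := fun q => if q.2 then y q.1 else x q.1
    -- For a fixed trace `T`, the factor at `k` vanishes if the point put in the first sample lies
    -- in `T`. The two choices at `k` therefore contribute `0 + 0`, `0 + 2` or `1 + 1`, at most `2`.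
    let h : Finset (Fin m × Bool) → Fin m → Bool → ℝ := fun T k s =>
      if (k, s) ∈ T then 0 else if (k, !s) ∈ T then 2 else 1
    have hh0 : ∀ T k s, 0 ≤ h T k s := fun T k s => by
      simp only [h]
      positivity
    have hterm : ∀ σ, g (sw σ (x, y)) ≤ ∑ T ∈ traces b z, ∏ k, h T k (σ k) := by
      intro σ
      set p := sw σ (x, y) with hp
      have hT : ({q | z q ∈ b (A p.1)} : Finset (Fin m × Bool)) ∈ traces b z := by
        simp only [traces, mem_filter, mem_univ, true_and]
        exact ⟨A p.1, rfl⟩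
      refine le_trans (le_of_eq ?_) (single_le_sum
        (f := fun T => ∏ k, h T k (σ k)) (fun T _ => prod_nonneg fun k _ => hh0 T k _) hT)
      refine prod_congr rfl fun k _ => ?_
      have hz1 : z (k, σ k) = p.1 k := by simp [z, hp, sw]
      have hz2 : z (k, !σ k) = p.2 k := by
        by_cases hk : σ k = true <;> simp [z, hp, sw, hk]
      simp only [h, mem_filter, mem_univ, true_and, hz1, hz2, if_neg (hA p.1 k)]
    calc ∑ σ, g (sw σ (x, y)) ≤ ∑ σ : Fin m → Bool, ∑ T ∈ traces b z, ∏ k, h T k (σ k) :=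
          sum_le_sum fun σ _ => hterm σ
      _ = ∑ T ∈ traces b z, ∑ σ : Fin m → Bool, ∏ k, h T k (σ k) := sum_comm
      _ ≤ ∑ T ∈ traces b z, (2 : ℝ) ^ m := by
          refine sum_le_sum fun T _ => ?_
          rw [← Fintype.piFinset_univ, ← prod_univ_sum (fun _ : Fin m => (univ : Finset Bool))
            (fun k s => h T k s)]
          calc ∏ k, ∑ s, h T k s ≤ ∏ k : Fin m, (2 : ℝ) := by
                refine prod_le_prod (fun k _ => sum_nonneg fun s _ => hh0 T k s) fun k _ => ?_
                by_cases hk : (k, true) ∈ T <;> by_cases hk' : (k, false) ∈ T <;>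
                  norm_num [h, hk, hk']
            _ = 2 ^ m := by simp
      _ = #(traces b z) * (2 : ℝ) ^ m := by rw [sum_const, nsmul_eq_mul]
      _ ≤ _ := by
          refine mul_le_mul_of_nonneg_right ?_ (by positivity)
          have := hb.card_traces_le z
          rw [Fintype.card_prod, Fintype.card_fin, Fintype.card_bool, mul_comm m 2] at this
          exact_mod_cast this
  have htot : (2 : ℝ) ^ m * ∑ p : (Fin m → V) × (Fin m → V), W p.1 * W p.2 * g p ≤
      (t * (2 * m + 1) ^ t : ℝ) * 2 ^ m := by
    calc (2 : ℝ) ^ m * ∑ p : (Fin m → V) × (Fin m → V), W p.1 * W p.2 * g p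
        = ∑ σ : Fin m → Bool, ∑ p : (Fin m → V) × (Fin m → V), W p.1 * W p.2 * g (sw σ p) := by
          simp_rw [hinv]
          simp
      _ = ∑ p : (Fin m → V) × (Fin m → V), W p.1 * W p.2 * ∑ σ, g (sw σ p) := by
          rw [sum_comm]
          simp_rw [mul_sum]
      _ ≤ ∑ p : (Fin m → V) × (Fin m → V), W p.1 * W p.2 * ((t * (2 * m + 1) ^ t : ℝ) * 2 ^ m) :=
          sum_le_sum fun p _ =>
            mul_le_mul_of_nonneg_left (hup p) (mul_nonneg (hW0 _) (hW0 _))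
      _ = _ := by
          rw [← sum_mul, Fintype.sum_prod_type, ← sum_mul_sum, hW1, one_mul, one_mul]
  have h2 : (0 : ℝ) < 2 ^ m := by positivity
  rw [mul_comm] at htot
  exact hlow.trans (le_of_mul_le_mul_right htot h2)

end DoubleSampling

theorem exists_mul_pow_lt_one_add_pow (t : ℕ) {δ : ℝ} (hδ : 0 < δ) :
    ∃ m : ℕ, (t * (2 * m + 1) ^ t : ℝ) < (1 + δ) ^ m := by
  have hlim := (tendsto_pow_const_div_const_pow_of_one_lt t (r := 1 + δ)
    (by linarith)).const_mul ((t : ℝ) * 3 ^ t)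
  rw [mul_zero] at hlim
  obtain ⟨m, hm, hm1⟩ := ((hlim.eventually (gt_mem_nhds one_pos)).and
    (Filter.eventually_ge_atTop 1)).exists
  refine ⟨m, ?_⟩
  have hm1' : (1 : ℝ) ≤ m := by exact_mod_cast hm1
  have hpos : (0 : ℝ) < (1 + δ) ^ m := by positivity
  rw [← mul_div_assoc, div_lt_one hpos] at hm
  refine lt_of_le_of_lt ?_ hm
  -- The factor `3 ^ t` absorbs `2 * m + 1 ≤ 3 * m`, valid for `m ≥ 1`.
  rw [mul_assoc, ← mul_pow]
  gcongr
  linarith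

end CutsNoPairs

/-- The **`ε`-net theorem** for families cutting no pairs. -/
theorem exists_net (t : ℕ) {δ : ℝ} (hδ : 0 < δ) :
    ∃ N : ℕ, ∀ {V ι : Type*} [Fintype V] [DecidableEq V] {b : ι → Finset V}, CutsNoPairs b t →
      ∀ {μ : V → ℝ}, (∀ v, 0 ≤ μ v) → ∑ v, μ v = 1 → (∀ a, δ ≤ ∑ v ∈ b a, μ v) →
      ∃ X : Finset V, #X ≤ N ∧ ∀ a, ¬ Disjoint X (b a) := by
  obtain ⟨m, hm⟩ := CutsNoPairs.exists_mul_pow_lt_one_add_pow t hδ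
  refine ⟨m, fun {V ι} _ _ {b} hb {μ} h0 h1 hle => ?_⟩
  by_contra! hcon
  refine not_le.2 hm (hb.one_add_pow_le h0 h1 hδ.le hle fun x => ?_)
  obtain ⟨a, ha⟩ := hcon (univ.image x) (card_image_le.trans (by simp))
  exact ⟨a, fun k => disjoint_left.1 ha (mem_image_of_mem x (mem_univ k))⟩

/-! ### Separated subfamilies and the packing bound -/

section Packing

variable {V ι : Type*} [DecidableEq V]

/-- Greedy selection in order of increasing weight: the selected sets overlap little, and each
set overlaps substantially with a selected one. -/
theorem exists_separated (b : ι → Finset V) (μ : V → ℝ) (h0 : ∀ v, 0 ≤ μ v) {δ : ℝ}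
    (hδ : δ ≤ 1) (F : Finset ι) :
    ∃ M ⊆ F, (∀ i ∈ M, ∀ j ∈ M, i ≠ j →
        ∑ v ∈ b i ∩ b j, μ v ≤ δ * min (∑ v ∈ b i, μ v) (∑ v ∈ b j, μ v)) ∧
      ∀ i ∈ F, ∃ j ∈ M, δ * ∑ v ∈ b j, μ v ≤ ∑ v ∈ b j ∩ b i, μ v := by
  classical
  induction F using Finset.induction_on_max_value (fun i => ∑ v ∈ b i, μ v) with
  | empty => exact ⟨∅, Subset.rfl, by simp, by simp⟩
  | insert a s ha hmax ih =>
    obtain ⟨M, hMs, hsep, hcov⟩ := ih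
    by_cases hc : ∃ j ∈ M, δ * ∑ v ∈ b j, μ v ≤ ∑ v ∈ b j ∩ b a, μ v
    · refine ⟨M, hMs.trans (subset_insert _ _), hsep, fun i hi => ?_⟩
      rcases mem_insert.1 hi with rfl | hi
      · exact hc
      · exact hcov i hi
    · push Not at hc
      -- The new set is the heaviest so far, so the minimum is the weight of the earlier set.
      have hmin : ∀ j ∈ M, ∑ v ∈ b j ∩ b a, μ v ≤
          δ * min (∑ v ∈ b j, μ v) (∑ v ∈ b a, μ v) := fun j hj => by
        rw [min_eq_left (hmax j (hMs hj))]
        exact (hc j hj).le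
      refine ⟨insert a M, insert_subset_insert _ hMs, fun i hi j hj hij => ?_, fun i hi => ?_⟩
      · rcases mem_insert.1 hi with hi' | hi' <;> rcases mem_insert.1 hj with hj' | hj'
        · exact absurd (hi'.trans hj'.symm) hij
        · rw [hi', inter_comm, min_comm]
          exact hmin j hj'
        · rw [hj']
          exact hmin i hi'
        · exact hsep i hi' j hj' hij
      · rcases mem_insert.1 hi with rfl | hi
        · refine ⟨i, mem_insert_self _ _, ?_⟩
          rw [inter_self]
          exact mul_le_of_le_one_left (sum_nonneg fun v _ => h0 v) hδ
        · obtain ⟨j, hj, hle⟩ := hcov i hi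
          exact ⟨j, mem_insert_of_mem hj, hle⟩

/-- A packing bound: sets with small pairwise overlaps have bounded total weight. -/
theorem HasSparseSupports.sum_sum_le_two [Fintype V] {b : ι → Finset V} {d : ℕ}
    (hb : HasSparseSupports b d) {μ : V → ℝ} (h0 : ∀ v, 0 ≤ μ v) (h1 : ∑ v, μ v = 1) {δ : ℝ}
    (hδ0 : 0 ≤ δ) (hδ : 4 * d * δ ≤ 1) {M : Finset ι}
    (hM : ∀ i ∈ M, ∀ j ∈ M, i ≠ j →
      ∑ v ∈ b i ∩ b j, μ v ≤ δ * min (∑ v ∈ b i, μ v) (∑ v ∈ b j, μ v)) :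
    ∑ i ∈ M, ∑ v ∈ b i, μ v ≤ 2 := by
  classical
  obtain ⟨Q, hQ, hQc⟩ := hb M
  set m : ι → ℝ := fun i => ∑ v ∈ b i, μ v with hm
  have hm0 : ∀ i, 0 ≤ m i := fun i => sum_nonneg fun v _ => h0 v
  -- The members through `v` are connected in the support, so their number is at most one plus their
  -- ordered adjacent pairs. Integrating against `μ` charges the excess to overlaps along support
  -- edges.
  have hcount : ∀ v, (#{i ∈ M | v ∈ b i} : ℝ) ≤
      1 + ∑ i ∈ M, ∑ j ∈ M, (if Q.Adj i j then (if v ∈ b i ∩ b j then 1 else 0) else 0) := by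
    intro v
    have := card_le_one_add_sum_adj (Q := Q) (D := {i ∈ M | v ∈ b i}) (by
      rw [coe_filter]
      exact hQc v)
    refine this.trans (le_of_eq ?_)
    congr 1
    rw [sum_filter]
    refine sum_congr rfl fun i _ => ?_
    rw [sum_filter]
    by_cases hi : v ∈ b i
    · rw [if_pos hi]
      refine sum_congr rfl fun j _ => ?_
      by_cases hj : v ∈ b j <;> simp [hi, hj]
    · simp [hi]
  have hsum : ∑ i ∈ M, m i ≤
      1 + ∑ i ∈ M, ∑ j ∈ M, (if Q.Adj i j then ∑ v ∈ b i ∩ b j, μ v else 0) := by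
    calc ∑ i ∈ M, m i = ∑ v, μ v * #{i ∈ M | v ∈ b i} := by
          have : ∀ i, m i = ∑ v, if v ∈ b i then μ v else 0 := fun i => by
            rw [sum_ite_mem, univ_inter]
          simp_rw [this]
          rw [sum_comm]
          refine sum_congr rfl fun v _ => ?_
          rw [← sum_filter, sum_const, nsmul_eq_mul, mul_comm]
      _ ≤ ∑ v, μ v * (1 + ∑ i ∈ M, ∑ j ∈ M,
            (if Q.Adj i j then (if v ∈ b i ∩ b j then 1 else 0) else 0)) :=
          sum_le_sum fun v _ => mul_le_mul_of_nonneg_left (hcount v) (h0 v)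
      _ = 1 + ∑ i ∈ M, ∑ j ∈ M, (if Q.Adj i j then ∑ v ∈ b i ∩ b j, μ v else 0) := by
          simp_rw [mul_add, mul_one, sum_add_distrib, h1, mul_sum]
          congr 1
          rw [sum_comm]
          refine sum_congr rfl fun i _ => ?_
          rw [sum_comm]
          refine sum_congr rfl fun j _ => ?_
          by_cases hij : Q.Adj i j
          · simp only [hij, if_true, mul_ite, mul_one, mul_zero, sum_ite_mem, univ_inter]
          · simp [hij]
  have hedge : ∑ i ∈ M, ∑ j ∈ M, (if Q.Adj i j then ∑ v ∈ b i ∩ b j, μ v else 0) ≤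
      δ * ∑ i ∈ M, ∑ j ∈ M, (if Q.Adj i j then min (m i) (m j) else 0) := by
    simp_rw [mul_sum]
    refine sum_le_sum fun i hi => sum_le_sum fun j hj => ?_
    by_cases hij : Q.Adj i j
    · simp only [hij, if_true]
      exact hM i hi j hj hij.ne
    · simp [hij]
  have hdeg := mul_le_mul_of_nonneg_left (sum_sum_adj_min_le hQ hm0) hδ0
  have hS : 0 ≤ ∑ i ∈ M, m i := sum_nonneg fun i _ => hm0 i
  -- The total weight `W` satisfies `W ≤ 1 + 2 * d * δ * W ≤ 1 + W / 2`.
  nlinarith [mul_le_mul_of_nonneg_right hδ hS]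

end Packing

/-! ### Linear nets and the conclusion -/

/-- Linear-size nets: for families with sparse supports that cut no pairs, sets of weight at least
`ε` have a hitting set of size `O(1 / ε)`. -/
theorem exists_linear_net (t d : ℕ) :
    ∃ N : ℕ, ∀ {V ι : Type*} [Fintype V] [DecidableEq V] [Finite ι] {b : ι → Finset V},
      HasSparseSupports b d → CutsNoPairs b t →
      ∀ {μ : V → ℝ}, (∀ v, 0 ≤ μ v) → ∑ v, μ v = 1 → ∀ {ε : ℝ}, 0 < ε →
      (∀ a, ε ≤ ∑ v ∈ b a, μ v) →
      ∃ X : Finset V, (#X : ℝ) * ε ≤ 2 * N ∧ ∀ a, ¬ Disjoint X (b a) := by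
  set δ : ℝ := 1 / (4 * d + 1) with hδ
  have hδ0 : 0 < δ := by positivity
  have hδ1 : δ ≤ 1 := by
    rw [hδ, div_le_one (by positivity)]
    linarith [(Nat.cast_nonneg d : (0 : ℝ) ≤ d)]
  have hδd : 4 * d * δ ≤ 1 := by
    rw [hδ, mul_one_div, div_le_one (by positivity)]
    linarith
  obtain ⟨N, hN⟩ := exists_net t hδ0
  refine ⟨N, fun {V ι} _ _ _ {b} hb hcut {μ} h0 h1 {ε} hε hle => ?_⟩
  have := Fintype.ofFinite ι
  obtain ⟨M, -, hsep, hcov⟩ := exists_separated b μ h0 hδ1 univ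
  -- Under `μ` conditioned on `b j`, every set overlapping `b j` substantially has weight at least
  -- `δ`, a constant depending only on `d`; the net size `N` is independent of `ε`.
  have hnet : ∀ j, ∃ X : Finset V, #X ≤ N ∧
      ∀ i, δ * ∑ v ∈ b j, μ v ≤ ∑ v ∈ b j ∩ b i, μ v → ¬ Disjoint X (b i) := by
    intro j
    have hj : 0 < ∑ v ∈ b j, μ v := hε.trans_le (hle j)
    have hmass : ∀ s : Finset V, ∑ v ∈ s, (if v ∈ b j then μ v / ∑ v ∈ b j, μ v else 0) =
        (∑ v ∈ b j ∩ s, μ v) / ∑ v ∈ b j, μ v := fun s => by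
      rw [sum_ite_mem, inter_comm, sum_div]
    obtain ⟨X, hX, hXb⟩ := hN
      (hcut.comp (Subtype.val : {i // δ * ∑ v ∈ b j, μ v ≤ ∑ v ∈ b j ∩ b i, μ v} → ι))
      (μ := fun v => if v ∈ b j then μ v / ∑ v ∈ b j, μ v else 0)
      (fun v => by
        split_ifs
        · exact div_nonneg (h0 v) hj.le
        · exact le_rfl)
      (by rw [hmass, inter_univ, div_self hj.ne'])
      (fun a => by
        rw [hmass, le_div_iff₀ hj]
        exact a.2)
    exact ⟨X, hX, fun i hi => hXb ⟨i, hi⟩⟩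
  choose X hX hXb using hnet
  refine ⟨M.biUnion X, ?_, fun i hdisj => ?_⟩
  · have hcard : (#(M.biUnion X) : ℝ) ≤ #M * N := by
      exact_mod_cast card_biUnion_le_card_mul M X N fun j _ => hX j
    have hMε : #M * ε ≤ 2 := by
      refine le_trans ?_ (hb.sum_sum_le_two h0 h1 hδ0.le hδd hsep)
      rw [← nsmul_eq_mul]
      exact card_nsmul_le_sum M _ ε fun j _ => hle j
    calc (#(M.biUnion X) : ℝ) * ε ≤ #M * N * ε := by gcongr
      _ = #M * ε * N := by ring
      _ ≤ 2 * N := by gcongr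
  · obtain ⟨j, hj, hji⟩ := hcov i (mem_univ i)
    exact hXb j i hji (disjoint_of_subset_left (subset_biUnion_of_mem X hj) hdisj)

/-- Linear Erdős–Pósa property of antichains of balls in graphs without `K_t` minor. -/
theorem exists_hitting_card_le (t : ℕ) :
    ∃ c : ℝ, ∀ {V ι : Type*} [Finite V] [Finite ι] {G : SimpleGraph V},
      G.CompleteMinorFree t → ∀ (x : ι → V) (r : ι → ℕ),
      (∀ i j, G.closedBall (x i) (r i) ⊆ G.closedBall (x j) (r j) → i = j) → ∀ n : ℕ, 1 ≤ n →
      (∀ M : Finset ι, (∀ i ∈ M, ∀ j ∈ M, i ≠ j →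
        Disjoint (G.closedBall (x i) (r i)) (G.closedBall (x j) (r j))) → #M ≤ n) →
      ∃ X : Finset V, (#X : ℝ) ≤ c * n ∧ ∀ i, ∃ v ∈ X, v ∈ G.closedBall (x i) (r i) := by
  obtain ⟨N, hN⟩ := exists_linear_net t (2 ^ t)
  -- The net has size at most `2 * N / ε` with `1 / ε = (8 * 2 ^ t + 1) * n + 1`, and `n ≥ 1`
  -- absorbs the last summand.
  refine ⟨2 * N * (8 * 2 ^ t + 2), fun {V ι} _ _ {G} hG x r hanti n hn hM => ?_⟩
  classical
  have := Fintype.ofFinite V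
  have := Fintype.ofFinite ι
  rcases isEmpty_or_nonempty V with hV | hV
  · exact ⟨∅, by simp; positivity, fun i => (hV.false (x i)).elim⟩
  set b : ι → Finset V := fun i => {v | v ∈ G.closedBall (x i) (r i)} with hb
  have hmem : ∀ i v, v ∈ b i ↔ v ∈ G.closedBall (x i) (r i) := fun i v => by simp [hb]
  have hsupp : HasSparseSupports b (2 ^ t) := by
    intro S
    obtain ⟨Q, hQ, hQc⟩ := hG.exists_support x r S fun i _ j _ => hanti i j
    refine ⟨Q, hQ, fun v => ?_⟩
    have hset : {i | i ∈ S ∧ v ∈ b i} = {i | i ∈ S ∧ v ∈ G.closedBall (x i) (r i)} := by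
      ext i
      exact and_congr_right fun _ => hmem i v
    rw [hset]
    exact hQc v
  have hcut : CutsNoPairs b t := fun y hy h => hG.not_all_pairs y hy fun i j hij => by
    obtain ⟨a, ha⟩ := h i j hij
    exact ⟨x a, r a, fun k => by rw [← hmem, ha]⟩
  obtain ⟨μ, h0, h1, hμ⟩ := hsupp.exists_weights
    (fun i => ⟨x i, (hmem _ _).2 (G.self_mem_closedBall _ _)⟩) (n := n) fun M hdisj => hM M
      fun i hi j hj hij => Set.disjoint_left.2 fun v hvi hvj =>
        disjoint_left.1 (hdisj i hi j hj hij) ((hmem _ _).2 hvi) ((hmem _ _).2 hvj)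
  obtain ⟨X, hX, hXb⟩ := hN hsupp hcut h0 h1 (by positivity) hμ
  refine ⟨X, ?_, fun i => ?_⟩
  · rw [mul_one_div, div_le_iff₀ (by positivity)] at hX
    push_cast at hX
    have hn' : (1 : ℝ) ≤ n := by exact_mod_cast hn
    have hle : ((8 * 2 ^ t + 1) * n + 1 : ℝ) ≤ (8 * 2 ^ t + 2) * n := by linarith
    calc (#X : ℝ) ≤ 2 * N * ((8 * 2 ^ t + 1) * n + 1) := hX
      _ ≤ 2 * N * ((8 * 2 ^ t + 2) * n) := mul_le_mul_of_nonneg_left hle (by positivity)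
      _ = _ := (mul_assoc _ _ _).symm
  · obtain ⟨v, hvX, hv⟩ := not_disjoint_iff.1 (hXb i)
    exact ⟨v, hvX, (hmem _ _).1 hv⟩

theorem theorem1p2 (t : ℕ) (ht : 1 ≤ t) :
    ∃ c : ℝ, ∀ (V : Type*) [Finite V] (G : SimpleGraph V), G.CompleteMinorFree t →
      ∀ H : Hypergraph V, G.IsBallHypergraph H →
        (H.transversalNumber : ℝ) ≤ c * (H.matchingNumber : ℝ) := by
  obtain ⟨c, hc⟩ := exists_hitting_card_le t
  refine ⟨c, fun V _ G hG H hH => ?_⟩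
  classical
  -- The minimal edges form an antichain; hitting them hits every edge, and their matchings are
  -- matchings of `H`.
  have hball : ∀ e : {e // Minimal (· ∈ H.edgeSet) e}, ∃ p : V × ℕ,
      e.1 = G.closedBall p.1 p.2 := fun e => by
    obtain ⟨v, r, h⟩ := hH.2 e e.2.prop
    exact ⟨(v, r), h⟩
  choose p hp using hball
  have hne : ∀ e ∈ H.edgeSet, e.Nonempty := fun e he => by
    obtain ⟨v, r, rfl⟩ := hH.2 e he
    exact ⟨v, G.self_mem_closedBall v r⟩
  have hmin : ∀ e ∈ H.edgeSet, ∃ f : {e // Minimal (· ∈ H.edgeSet) e}, f.1 ⊆ e := fun e he => by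
    obtain ⟨f, hfe, hf⟩ := (Set.toFinite H.edgeSet).exists_le_minimal he
    exact ⟨⟨f, hf⟩, hfe⟩
  have htrans : ∀ X : Finset V, (∀ f : {e // Minimal (· ∈ H.edgeSet) e}, ∃ v ∈ X, v ∈ f.1) →
      H.transversalNumber ≤ #X := fun X hX => by
    refine (H.isLeast_transversalNumber hne).2 ⟨X, ⟨by simp [hH.1], fun e he => ?_⟩, rfl⟩
    obtain ⟨f, hfe⟩ := hmin e he
    obtain ⟨v, hvX, hv⟩ := hX f
    exact ⟨v, hvX, hfe hv⟩
  have hmatch : ∀ M : Finset {e // Minimal (· ∈ H.edgeSet) e},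
      (∀ i ∈ M, ∀ j ∈ M, i ≠ j → Disjoint i.1 j.1) → #M ≤ H.matchingNumber := fun M hM => by
    refine H.isGreatest_matchingNumber.2 ⟨M.map ⟨Subtype.val, Subtype.val_injective⟩,
      ⟨?_, ?_⟩, card_map _⟩
    · intro e he
      obtain ⟨f, -, rfl⟩ := mem_map.1 (mem_coe.1 he)
      exact f.2.prop
    · intro e he f hf hef
      obtain ⟨i, hi, rfl⟩ := mem_map.1 (mem_coe.1 he)
      obtain ⟨j, hj, rfl⟩ := mem_map.1 (mem_coe.1 hf)
      exact hM i hi j hj fun h => hef (h ▸ rfl)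
  -- Without edges both numbers vanish; otherwise a single edge gives the required `1 ≤ ν`.
  rcases isEmpty_or_nonempty {e // Minimal (· ∈ H.edgeSet) e} with hE | ⟨⟨f⟩⟩
  · have h0 : H.transversalNumber = 0 := by
      simpa using htrans ∅ fun f => (hE.false f).elim
    have hm : H.matchingNumber = 0 := by
      obtain ⟨M, hM, hcard⟩ := H.isGreatest_matchingNumber.1
      rw [← hcard, card_eq_zero, eq_empty_iff_forall_notMem]
      intro e he
      obtain ⟨f, -⟩ := hmin e (hM.1 he)
      exact hE.false f
    simp [h0, hm]
  · obtain ⟨X, hX, hXb⟩ := hc hG (fun i => (p i).1) (fun i => (p i).2)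
      (fun i j hij => by
        rw [← hp, ← hp] at hij
        exact Subtype.ext (j.2.eq_of_subset i.2.prop hij)) H.matchingNumber
      (by simpa using hmatch {f} (by simp))
      (fun M hM => hmatch M (by simpa only [← hp] using hM))
    refine le_trans ?_ hX
    exact_mod_cast htrans X fun f => by simpa only [← hp] using hXb f
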